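/- Let $I\subseteq\mathbb R$ be a nonempty open interval, $e\in I$, and let $m$ be a Radon measure on $I$ with full support. A scaling function on $I$ is a strictly increasing continuous function $s:I\to\mathbb R$ with $s(e)=0$; $ds$ denotes its Stieltjes measure. For a scaling function $s$ put $$\mathcal E^{(s,m)}(u,v)=\frac12\int_I\frac{du}{ds}\frac{dv}{ds}\,ds$$ for $u,v\in L^2(I,m)$ that are absolutely continuous with respect to $s$ with $du/ds,\,dv/ds\in L^2(I,ds)$, and let $\mathcal F^{(s,m)}_0$ be the closure, in the norm $\|u\|_{\mathcal E_1}=\big(\mathcal E^{(s,m)}(u,u)+\|u\|_{L^2(m)}^2\big)^{1/2}$, of $\{\varphi\circ s:\varphi\in C_c^\infty(s(I))\}$. Thus $(\mathcal E^{(s,m)},\mathcal F_0^{(s,m)})$ is the Dirichlet form on $L^2(I,m)$ of the minimal diffusion on $I$ with scaling function $s$, speed measure $m$ and no killing inside. Fix a scaling function $s$, write $(\mathcal E,\mathcal F)=(\mathcal E^{(s,m)},\mathcal F_0^{(s,m)})$, and assume $C_c^\infty(I)\subset\mathcal F$. Let $ds=g\,\lambda_I+\kappa$, $\kappa\perp\lambda_I$,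 be the Lebesgue decomposition of $ds$ with respect to Lebesgue measure $\lambda_I$ on $I$, and let $\bar s(x)=\int_e^x g\,d\lambda_I$ be the absolutely continuous part of $s$. Let $\bar{\mathcal F}$ be the $\|\cdot\|_{\mathcal E_1}$-closure of $C_c^\infty(I)$ in $\mathcal F$ and $\bar{\mathcal E}$ the restriction of $\mathcal E$ to $\bar{\mathcal F}$. **Theorem 2.2.** The function $\bar s$ is a scaling function, and $$(\bar{\mathcal E},\bar{\mathcal F})=(\mathcal E^{(\bar s,m)},\mathcal F_0^{(\bar s,m)}).$$ This form is the smallest closed extension of $\mathcal E$ restricted to $C_c^\infty(I)$, and it is a regular Dirichlet subspace of $(\mathcal E,\mathcal F)$: both are regular Dirichlet forms on $L^2(I,m)$, $\bar{\mathcal F}\subset\mathcal F$, and $\bar{\mathcal E}=\mathcal E$ on $\bar{\mathcal F}\times\bar{\mathcal F}$. In particular, $C_c^\infty(I)$ is a special standard core of $(\mathcal E,\mathcal F)$ if and only if $s$ is absolutely continuous on every compact subinterval of $I$. Here a *core* of a Dirichlet form $(\mathcal E,\mathcal F)$ is a set $\mathcal C\subset\mathcal F\cap C_c(I)$ that is $\|\cdot\|_{\mathcal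 E_1}$-dense in $\mathcal F$ and uniformly dense in $C_c(I)$; the form is *regular* if it has a core. The core $\mathcal C$ is *special standard* if it is a subalgebra of $C_c(I)$; for every $\varepsilon>0$ there is $\varphi_\varepsilon:\mathbb R\to\mathbb R$ with $\varphi_\varepsilon(t)=t$ on $[0,1]$, $-\varepsilon\le\varphi_\varepsilon\le1+\varepsilon$, $0\le\varphi_\varepsilon(t')-\varphi_\varepsilon(t)\le t'-t$ for $t<t'$, and $\varphi_\varepsilon\circ f\in\mathcal C$ for all $f\in\mathcal C$; and for all compact $K$ and relatively compact open $G\supset K$ there is $f\in\mathcal C$ with $f\ge0$, $f=1$ on $K$ and $f=0$ off $G$. -/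

import Mathlib

open MeasureTheory Set Filter
open scoped ContDiff ENNReal

/-! ### Forms on `L²(X, m)` -/

noncomputable section Forms

variable {X : Type*} [TopologicalSpace X] [MeasurableSpace X] {m : Measure X}

/-- A form `(𝓔, 𝓕)` on `L²(X, m)`: the domain `𝓕 ⊆ L²(X, m)` and the values `𝓔(u, v)`.
Only the values at `u, v ∈ 𝓕` carry meaning. The algebraic laws and closedness are stated in
`L2Form.IsClosedForm`. -/
structure L2Form (m : Measure X) where
  domain : Set (Lp ℝ 2 m)
  form : Lp ℝ 2 m → Lp ℝ 2 m → ℝ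

namespace L2Form

/-- `‖u‖²` for the `𝓔₁`-norm: `𝓔₁(u, u) = 𝓔(u, u) + (u, u)_m`. -/
def energyOne (𝓔 : L2Form m) (u : Lp ℝ 2 m) : ℝ := 𝓔.form u u + ‖u‖ ^ 2

/-- The function `f` belongs to the domain (more precisely, its `m`-class does). -/
def Mem (𝓔 : L2Form m) (f : X → ℝ) : Prop := ∃ w ∈ 𝓔.domain, w =ᵐ[m] f

/-- The form `𝓔` restricted to the `m`-classes in `𝓕` of the functions in `C`. -/
def restrict (𝓔 : L2Form m) (C : Set (X → ℝ)) : L2Form m where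
  domain := {w | w ∈ 𝓔.domain ∧ ∃ f ∈ C, w =ᵐ[m] f}
  form := 𝓔.form

/-- The set of those `u ∈ 𝓕` that are approximated by functions of `C` in the `𝓔₁`-norm:
the closure of `C` in `𝓕`. -/
def closureIn (𝓔 : L2Form m) (C : Set (X → ℝ)) : Set (Lp ℝ 2 m) :=
  {u | u ∈ 𝓔.domain ∧
    ∀ ε > 0, ∃ f ∈ C, ∃ w ∈ 𝓔.domain, w =ᵐ[m] f ∧ 𝓔.energyOne (u - w) < ε}

/-- `𝓔'` extends `𝓔`. -/
def Extends (𝓔' 𝓔 : L2Form m) : Prop :=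
  𝓔.domain ⊆ 𝓔'.domain ∧ ∀ u ∈ 𝓔.domain, ∀ v ∈ 𝓔.domain, 𝓔'.form u v = 𝓔.form u v

/-- A closed symmetric form on `L²(X, m)`: a non-negative definite symmetric bilinear form whose
domain is a dense linear subspace, complete for the `𝓔₁`-norm. -/
structure IsClosedForm (𝓔 : L2Form m) : Prop where
  zero_mem : (0 : Lp ℝ 2 m) ∈ 𝓔.domain
  add_mem : ∀ u ∈ 𝓔.domain, ∀ v ∈ 𝓔.domain, u + v ∈ 𝓔.domain
  smul_mem : ∀ (c : ℝ), ∀ u ∈ 𝓔.domain, c • u ∈ 𝓔.domain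
  dense : Dense 𝓔.domain
  symm : ∀ u ∈ 𝓔.domain, ∀ v ∈ 𝓔.domain, 𝓔.form u v = 𝓔.form v u
  add_left : ∀ u ∈ 𝓔.domain, ∀ v ∈ 𝓔.domain, ∀ w ∈ 𝓔.domain,
    𝓔.form (u + v) w = 𝓔.form u w + 𝓔.form v w
  smul_left : ∀ (c : ℝ), ∀ u ∈ 𝓔.domain, ∀ v ∈ 𝓔.domain, 𝓔.form (c • u) v = c * 𝓔.form u v
  nonneg : ∀ u ∈ 𝓔.domain, 0 ≤ 𝓔.form u u
  complete : ∀ u : ℕ → Lp ℝ 2 m, (∀ n, u n ∈ 𝓔.domain) →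
    (∀ ε > 0, ∃ N, ∀ p ≥ N, ∀ q ≥ N, 𝓔.energyOne (u p - u q) < ε) →
    ∃ v ∈ 𝓔.domain, Tendsto (fun n => 𝓔.energyOne (u n - v)) atTop (nhds 0)

/-- A Dirichlet form: a closed symmetric form on which the unit contraction operates. -/
structure IsDirichletForm (𝓔 : L2Form m) : Prop extends 𝓔.IsClosedForm where
  unit_contraction : ∀ u ∈ 𝓔.domain, ∀ v : Lp ℝ 2 m, (v =ᵐ[m] fun x => min (max (u x) 0) 1) →
    v ∈ 𝓔.domain ∧ 𝓔.form v v ≤ 𝓔.form u u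

/-- `C ⊆ 𝓕 ∩ C_c(X)` is a core of `(𝓔, 𝓕)`: it is `𝓔₁`-dense in `𝓕` and uniformly dense in
`C_c(X)`. -/
structure IsCore (𝓔 : L2Form m) (C : Set (X → ℝ)) : Prop where
  continuous : ∀ f ∈ C, Continuous f
  compactSupport : ∀ f ∈ C, HasCompactSupport f
  mem : ∀ f ∈ C, 𝓔.Mem f
  dense_domain : 𝓔.closureIn C = 𝓔.domain
  dense_uniform : ∀ h : X → ℝ, Continuous h → HasCompactSupport h →
    ∀ ε > 0, ∃ f ∈ C, ∀ x, |h x - f x| < ε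

/-- A standard core: a core that is a linear space and is stable under composition with some
approximation `φ_ε` of the unit contraction, for every `ε > 0`. -/
structure IsStandardCore (𝓔 : L2Form m) (C : Set (X → ℝ)) : Prop extends 𝓔.IsCore C where
  zero_mem : (0 : X → ℝ) ∈ C
  add_mem : ∀ f ∈ C, ∀ g ∈ C, f + g ∈ C
  smul_mem : ∀ (c : ℝ), ∀ f ∈ C, c • f ∈ C
  contraction : ∀ ε > 0, ∃ φ : ℝ → ℝ, (∀ t ∈ Icc (0 : ℝ) 1, φ t = t) ∧
    (∀ t, -ε ≤ φ t ∧ φ t ≤ 1 + ε) ∧ (∀ t t', t < t' → 0 ≤ φ t' - φ t ∧ φ t' - φ t ≤ t' - t) ∧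
    ∀ f ∈ C, φ ∘ f ∈ C

/-- A special standard core: a standard core that is an algebra and has cut-off functions. -/
structure IsSpecialStandardCore (𝓔 : L2Form m) (C : Set (X → ℝ)) : Prop
    extends 𝓔.IsStandardCore C where
  mul_mem : ∀ f ∈ C, ∀ g ∈ C, f * g ∈ C
  cutoff : ∀ K G : Set X, IsCompact K → IsOpen G → IsCompact (closure G) → K ⊆ G →
    ∃ f ∈ C, (∀ x, 0 ≤ f x) ∧ (∀ x ∈ K, f x = 1) ∧ ∀ x ∉ G, f x = 0

/-- A regular Dirichlet form: a Dirichlet form that has a core. -/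
structure IsRegularDirichletForm (𝓔 : L2Form m) : Prop extends 𝓔.IsDirichletForm where
  exists_core : ∃ C : Set (X → ℝ), 𝓔.IsCore C

/-- `𝓔'` is a regular Dirichlet subspace of `𝓔`: both are regular Dirichlet forms on `L²(X, m)`,
`𝓕' ⊆ 𝓕`, and `𝓔 = 𝓔'` on `𝓕' × 𝓕'`. -/
def IsRegularDirichletSubspace (𝓔' 𝓔 : L2Form m) : Prop :=
  𝓔'.IsRegularDirichletForm ∧ 𝓔.IsRegularDirichletForm ∧ 𝓔.Extends 𝓔'

/-- `𝓔'` is the smallest closed extension of `𝓔`. In particular `𝓔` is closable. -/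
def IsSmallestClosedExtension (𝓔' 𝓔 : L2Form m) : Prop :=
  𝓔'.IsClosedForm ∧ 𝓔'.Extends 𝓔 ∧
    ∀ 𝓓 : L2Form m, 𝓓.IsClosedForm → 𝓓.Extends 𝓔 → 𝓓.Extends 𝓔'

end L2Form

end Forms

/-! ### Scaling functions on an interval and their Dirichlet forms -/

noncomputable section Scale

/-- `C_c^∞(U)` for `U ⊆ ℝ` open; its members are extended by zero to `ℝ`. -/
def testFun (U : Set ℝ) : Set (ℝ → ℝ) :=
  {φ | ContDiff ℝ ∞ φ ∧ HasCompactSupport φ ∧ tsupport φ ⊆ U}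

variable {I : Set ℝ}

/-- `C_c^∞(I)`, as functions on `I`. -/
def testFunOn (I : Set ℝ) : Set (I → ℝ) := {f | ∃ φ ∈ testFun I, f = fun x : I => φ x}

/-- `C_c^∞ ∘ s = {φ ∘ s : φ ∈ C_c^∞(J)}` with `J = s(I)`. -/
def testFunComp (s : I → ℝ) : Set (I → ℝ) := {f | ∃ φ ∈ testFun (range s), f = φ ∘ s}

/-- A scaling function on `I`, normalised to vanish at `e`. -/
structure IsScale (e : I) (s : I → ℝ) : Prop where
  strictMono : StrictMono s
  continuous : Continuous s
  base : s e = 0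

/-- The Stieltjes measure `ds` on `I` of a continuous strictly increasing `s`:
the mass of `A` is the Lebesgue measure of `s(A)`. See `scaleMeasure_Ioc`. -/
def scaleMeasure (s : I → ℝ) : Measure I := Measure.comap s volume

/-- `ds((x, y]) = s(y) - s(x)`. -/
theorem scaleMeasure_Ioc (hI : I.OrdConnected) {e : I} {s : I → ℝ} (hs : IsScale e s) (x y : I) :
    scaleMeasure s (Ioc x y) = ENNReal.ofReal (s y - s x) := by
  have hp : PreconnectedSpace I := Subtype.preconnectedSpace hI.isPreconnected
  have : StandardBorelSpace I := hI.measurableSet.standardBorel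
  have hm : MeasurableEmbedding s :=
    hs.continuous.measurable.measurableEmbedding hs.strictMono.injective
  rw [scaleMeasure, hm.comap_apply]
  have : s '' Ioc x y = Ioc (s x) (s y) := by
    ext z
    constructor
    · rintro ⟨w, hw, rfl⟩
      exact ⟨hs.strictMono hw.1, hs.strictMono.monotone hw.2⟩
    · intro hz
      obtain ⟨w, rfl⟩ := mem_range_of_exists_le_of_exists_ge hs.continuous
        ⟨x, hz.1.le⟩ ⟨y, hz.2⟩
      exact ⟨w, ⟨hs.strictMono.lt_iff_lt.1 hz.1, hs.strictMono.le_iff_le.1 hz.2⟩, rfl⟩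
  rw [this, Real.volume_Ioc]

/-- `u ∈ L²(I, m)` has a version that is absolutely continuous with respect to `s`, with
derivative `du/ds = φ ∈ L²(I, ds)`. -/
def HasScaleDeriv {m : Measure I} (s : I → ℝ) (u : Lp ℝ 2 m) (φ : I → ℝ) : Prop :=
  MemLp φ 2 (scaleMeasure s) ∧ ∃ v : I → ℝ, u =ᵐ[m] v ∧
    ∀ x y : I, x ≤ y → v y - v x = ∫ z in Ioc x y, φ z ∂(scaleMeasure s)

open Classical in
/-- `du/ds`, which is `ds`-a.e. unique if it exists and `m` has full support. -/
def scaleDeriv {m : Measure I} (s : I → ℝ) (u : Lp ℝ 2 m) : I → ℝ :=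
  if h : ∃ φ, HasScaleDeriv s u φ then h.choose else 0

/-- `𝓔(u, v) = ½ ∫ (du/ds) (dv/ds) ds` on all `u ∈ L²(I, m)` that are absolutely continuous with
respect to `s` and have `du/ds ∈ L²(I, ds)`. -/
def maxScaleForm (s : I → ℝ) (m : Measure I) : L2Form m where
  domain := {u | ∃ φ, HasScaleDeriv s u φ}
  form u v := 1 / 2 * ∫ x, scaleDeriv s u x * scaleDeriv s v x ∂(scaleMeasure s)

/-- The Dirichlet form of the minimal diffusion on `I` with scaling function `s`, speed measure
`m` and no killing inside: the domain is the `𝓔₁`-closure of `C_c^∞ ∘ s`. -/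
def scaleForm (s : I → ℝ) (m : Measure I) : L2Form m where
  domain := (maxScaleForm s m).closureIn (testFunComp s)
  form := (maxScaleForm s m).form

/-- The Lebesgue measure `λ_I` on `I`. -/
def lebesgueOn (I : Set ℝ) : Measure I := Measure.comap Subtype.val volume

/-- The density `g` in the Lebesgue decomposition `ds = g · λ_I + κ`, `κ ⟂ λ_I`. -/
def acDensity (s : I → ℝ) (x : I) : ℝ := ((scaleMeasure s).rnDeriv (lebesgueOn I) x).toReal

/-- The absolutely continuous part `x ↦ ∫_e^x g dλ_I` of `s`. -/
def acPart (e : I) (s : I → ℝ) (x : I) : ℝ :=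
  (∫ y in Ioc e x, acDensity s y ∂(lebesgueOn I)) - ∫ y in Ioc x e, acDensity s y ∂(lebesgueOn I)

/-- `s` is (locally) absolutely continuous on the interval `I`: absolutely continuous, in the
`ε`-`δ` sense, on every compact subinterval of `I`. The extension of `s` outside of `I` by `0` is
irrelevant here. -/
def IsACOn (s : I → ℝ) : Prop :=
  ∀ x y : I, x ≤ y →
    AbsolutelyContinuousOnInterval (Function.extend Subtype.val s (fun _ => 0)) x y

end Scale

/-! Write `ds = g λ + κ` and `ds̄ = g λ`. Cutting off the identity on a compact interval gives a
test function, and it lies in the domain of `𝓔`; hence locally `λ = ψ ds` with `ψ ∈ L²(ds)`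
(`IsCoord.exists_memLp_of_mem`). Off a Lebesgue-null set carrying `κ` this says `g ψ = 1` a.e.
(`IsCoord.ae_acDensity_mul_eq_one`). So `g > 0` a.e., which makes `s̄` strictly increasing, and
`1/g` is locally square integrable for `ds̄`, because `ψ` is so for `ds` and `ds̄ ≤ ds`.

Moreover `ds̄` is the restriction of `ds` to a set `A`. A derivative with respect to `s̄`, set to
zero off `A`, is one with respect to `s`, so the maximal form of `s` extends that of `s̄`
(`IsCoord.maxScaleForm_extends`). By completeness, closures do not change between a closed form and
a closed extension (`closureIn_eq_of_extends`). Everything thus takes place in the maximal form of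
`s̄`, where the closures of `C_c^∞(I)` and of `C_c^∞ ∘ s̄` have to be compared.

Both are test functions of a coordinate `t` with `dt = k ds̄`, where `k` is a.e. nonzero and locally
in `L²(ds̄)`: `k = 1` for `t = s̄`, and `k = 1/g` for the inclusion. For every such `t` the closure
contains all compactly supported functions with `L²` derivative
(`HasSqDensity.mem_closureIn_testFunComp`): approximate the derivative by `F(t) k`, subtract a
multiple of a bump to make the integral zero, integrate, and control the `L²(m)`-norm by a Poincaré
inequality. Hence each family lies in the closure of the other.

The Dirichlet property follows from smooth approximate contractions and lower semicontinuity of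
closed forms. For the final equivalence, if `C_c^∞(I)` is a core then the functions `φ ∘ s` lie in
the domain for `s̄`, so that `ds` has locally a density with respect to `ds̄`, hence with respect to
`λ`. Conversely, an absolutely continuous `s` equals `s̄`. -/

set_option linter.unusedSectionVars false

/-! ### Closed forms -/

section ClosedForms

variable {X : Type*} [MeasurableSpace X] {m : Measure X}

/-- A set of functions that is a linear space. -/
structure IsLinearSpace (C : Set (X → ℝ)) : Prop where
  zero_mem : (0 : X → ℝ) ∈ C
  add_mem : ∀ f ∈ C, ∀ g ∈ C, f + g ∈ C
  smul_mem : ∀ (c : ℝ), ∀ f ∈ C, c • f ∈ C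

namespace L2Form

/-- The restriction of `𝓔` to the closure of `C`. -/
def closureForm (𝓔 : L2Form m) (C : Set (X → ℝ)) : L2Form m where
  domain := 𝓔.closureIn C
  form := 𝓔.form

/-- Convergence in the `𝓔₁`-norm. -/
def Conv (𝓔 : L2Form m) (u : ℕ → Lp ℝ 2 m) (v : Lp ℝ 2 m) : Prop :=
  Tendsto (fun n => 𝓔.energyOne (u n - v)) atTop (nhds 0)

namespace IsClosedForm

variable {𝓔 𝓔' : L2Form m} {u v w : Lp ℝ 2 m} {C C' : Set (X → ℝ)}

theorem neg_mem (h : 𝓔.IsClosedForm) (hu : u ∈ 𝓔.domain) : -u ∈ 𝓔.domain := by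
  simpa using h.smul_mem (-1) u hu

theorem sub_mem (h : 𝓔.IsClosedForm) (hu : u ∈ 𝓔.domain) (hv : v ∈ 𝓔.domain) :
    u - v ∈ 𝓔.domain := by
  simpa [sub_eq_add_neg] using h.add_mem u hu _ (h.neg_mem hv)

theorem form_neg_left (h : 𝓔.IsClosedForm) (hu : u ∈ 𝓔.domain) (hv : v ∈ 𝓔.domain) :
    𝓔.form (-u) v = -𝓔.form u v := by
  simpa using h.smul_left (-1) u hu v hv

theorem form_sub_left (h : 𝓔.IsClosedForm) (hu : u ∈ 𝓔.domain) (hv : v ∈ 𝓔.domain)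
    (hw : w ∈ 𝓔.domain) : 𝓔.form (u - v) w = 𝓔.form u w - 𝓔.form v w := by
  rw [sub_eq_add_neg, h.add_left u hu _ (h.neg_mem hv) w hw, h.form_neg_left hv hw]; ring

theorem form_add_right (h : 𝓔.IsClosedForm) (hu : u ∈ 𝓔.domain) (hv : v ∈ 𝓔.domain)
    (hw : w ∈ 𝓔.domain) : 𝓔.form w (u + v) = 𝓔.form w u + 𝓔.form w v := by
  rw [h.symm w hw _ (h.add_mem u hu v hv), h.add_left u hu v hv w hw, h.symm u hu w hw,
    h.symm v hv w hw]

theorem form_sub_right (h : 𝓔.IsClosedForm) (hu : u ∈ 𝓔.domain) (hv : v ∈ 𝓔.domain)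
    (hw : w ∈ 𝓔.domain) : 𝓔.form w (u - v) = 𝓔.form w u - 𝓔.form w v := by
  rw [h.symm w hw _ (h.sub_mem hu hv), h.form_sub_left hu hv hw, h.symm u hu w hw,
    h.symm v hv w hw]

theorem form_smul_right (h : 𝓔.IsClosedForm) (c : ℝ) (hu : u ∈ 𝓔.domain) (hw : w ∈ 𝓔.domain) :
    𝓔.form w (c • u) = c * 𝓔.form w u := by
  rw [h.symm w hw _ (h.smul_mem c u hu), h.smul_left c u hu w hw, h.symm u hu w hw]

theorem form_add_self (h : 𝓔.IsClosedForm) (hu : u ∈ 𝓔.domain) (hv : v ∈ 𝓔.domain) :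
    𝓔.form (u + v) (u + v) = 𝓔.form u u + 2 * 𝓔.form u v + 𝓔.form v v := by
  rw [h.add_left u hu v hv _ (h.add_mem u hu v hv), h.form_add_right hu hv hu,
    h.form_add_right hu hv hv, h.symm v hv u hu]; ring

theorem form_sub_self (h : 𝓔.IsClosedForm) (hu : u ∈ 𝓔.domain) (hv : v ∈ 𝓔.domain) :
    𝓔.form (u - v) (u - v) = 𝓔.form u u - 2 * 𝓔.form u v + 𝓔.form v v := by
  rw [h.form_sub_left hu hv (h.sub_mem hu hv), h.form_sub_right hu hv hu,
    h.form_sub_right hu hv hv, h.symm v hv u hu]; ring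

theorem form_smul_self (h : 𝓔.IsClosedForm) (c : ℝ) (hu : u ∈ 𝓔.domain) :
    𝓔.form (c • u) (c • u) = c ^ 2 * 𝓔.form u u := by
  rw [h.smul_left c u hu _ (h.smul_mem c u hu), h.form_smul_right c hu hu]; ring

theorem form_sub_comm (h : 𝓔.IsClosedForm) (hu : u ∈ 𝓔.domain) (hv : v ∈ 𝓔.domain) :
    𝓔.form (u - v) (u - v) = 𝓔.form (v - u) (v - u) := by
  rw [h.form_sub_self hu hv, h.form_sub_self hv hu, h.symm u hu v hv]; ring

theorem energyOne_sub_comm (h : 𝓔.IsClosedForm) (hu : u ∈ 𝓔.domain) (hv : v ∈ 𝓔.domain) :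
    𝓔.energyOne (u - v) = 𝓔.energyOne (v - u) := by
  rw [energyOne, energyOne, h.form_sub_comm hu hv, norm_sub_rev]

theorem energyOne_nonneg (h : 𝓔.IsClosedForm) (hu : u ∈ 𝓔.domain) : 0 ≤ 𝓔.energyOne u :=
  add_nonneg (h.nonneg u hu) (sq_nonneg _)

/-- The parallelogram law with the difference term dropped. Working with squared norms costs a
factor 2, harmless in the approximation arguments, and avoids square roots. -/
theorem energyOne_add_le (h : 𝓔.IsClosedForm) (hu : u ∈ 𝓔.domain) (hv : v ∈ 𝓔.domain) :
    𝓔.energyOne (u + v) ≤ 2 * 𝓔.energyOne u + 2 * 𝓔.energyOne v := by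
  have h1 := h.form_add_self hu hv
  have h2 := h.form_sub_self hu hv
  have h3 := h.nonneg _ (h.sub_mem hu hv)
  have h4 : ‖u + v‖ ^ 2 ≤ 2 * ‖u‖ ^ 2 + 2 * ‖v‖ ^ 2 := by
    have := norm_add_le u v
    nlinarith [norm_nonneg (u + v), sq_nonneg (‖u‖ - ‖v‖)]
  unfold energyOne
  linarith

theorem energyOne_sub_le (h : 𝓔.IsClosedForm) (hu : u ∈ 𝓔.domain) (hv : v ∈ 𝓔.domain)
    (hw : w ∈ 𝓔.domain) :
    𝓔.energyOne (u - w) ≤ 2 * 𝓔.energyOne (u - v) + 2 * 𝓔.energyOne (v - w) := by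
  have := h.energyOne_add_le (h.sub_mem hu hv) (h.sub_mem hv hw)
  simpa using this

theorem energyOne_smul (h : 𝓔.IsClosedForm) (c : ℝ) (hu : u ∈ 𝓔.domain) :
    𝓔.energyOne (c • u) = c ^ 2 * 𝓔.energyOne u := by
  rw [energyOne, energyOne, h.form_smul_self c hu, norm_smul, mul_pow, Real.norm_eq_abs, sq_abs]
  ring

theorem form_zero (h : 𝓔.IsClosedForm) : 𝓔.form 0 0 = 0 := by
  simpa using h.smul_left 0 0 h.zero_mem 0 h.zero_mem

theorem energyOne_zero (h : 𝓔.IsClosedForm) : 𝓔.energyOne 0 = 0 := by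
  simp [energyOne, h.form_zero]

theorem cauchy_schwarz (h : 𝓔.IsClosedForm) (hu : u ∈ 𝓔.domain) (hv : v ∈ 𝓔.domain) :
    |𝓔.form u v| ≤ √(𝓔.form u u) * √(𝓔.form v v) := by
  have key : ∀ t : ℝ, 0 ≤ 𝓔.form v v * (t * t) + 2 * 𝓔.form u v * t + 𝓔.form u u := fun t => by
    have h1 := h.nonneg _ (h.add_mem u hu _ (h.smul_mem t v hv))
    rw [h.form_add_self hu (h.smul_mem t v hv), h.form_smul_self t hv,
      h.form_smul_right t hv hu] at h1
    linarith
  have h2 := discrim_le_zero key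
  rw [discrim] at h2
  rw [← Real.sqrt_mul (h.nonneg u hu)]
  apply Real.abs_le_sqrt
  linarith

theorem conv_form_zero (h : 𝓔.IsClosedForm) {u : ℕ → Lp ℝ 2 m} (hu : ∀ n, u n ∈ 𝓔.domain)
    (hv : v ∈ 𝓔.domain) (hc : 𝓔.Conv u v) :
    Tendsto (fun n => 𝓔.form (u n - v) (u n - v)) atTop (nhds 0) :=
  squeeze_zero (fun n => h.nonneg _ (h.sub_mem (hu n) hv))
    (fun n => le_add_of_nonneg_right (sq_nonneg ‖u n - v‖)) hc

theorem conv_tendsto (h : 𝓔.IsClosedForm) {u : ℕ → Lp ℝ 2 m} (hu : ∀ n, u n ∈ 𝓔.domain)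
    (hv : v ∈ 𝓔.domain) (hc : 𝓔.Conv u v) : Tendsto u atTop (nhds v) := by
  rw [tendsto_iff_norm_sub_tendsto_zero]
  have h1 : Tendsto (fun n => ‖u n - v‖ ^ 2) atTop (nhds 0) :=
    squeeze_zero (fun n => sq_nonneg _)
      (fun n => le_add_of_nonneg_left (h.nonneg _ (h.sub_mem (hu n) hv))) hc
  have h2 := h1.sqrt
  simpa using h2

theorem conv_form_left (h : 𝓔.IsClosedForm) {u : ℕ → Lp ℝ 2 m} (hu : ∀ n, u n ∈ 𝓔.domain)
    (hv : v ∈ 𝓔.domain) (hc : 𝓔.Conv u v) {a : ℕ → Lp ℝ 2 m} (ha : ∀ n, a n ∈ 𝓔.domain)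
    {B : ℝ} (hB : ∀ n, 𝓔.form (a n) (a n) ≤ B) :
    Tendsto (fun n => 𝓔.form (u n - v) (a n)) atTop (nhds 0) := by
  rw [tendsto_zero_iff_abs_tendsto_zero]
  have h1 : Tendsto (fun n => √(𝓔.form (u n - v) (u n - v)) * √B) atTop (nhds 0) := by
    simpa using (h.conv_form_zero hu hv hc).sqrt.mul_const (√B)
  refine squeeze_zero (fun n => abs_nonneg _) (fun n => ?_) h1
  refine (h.cauchy_schwarz (h.sub_mem (hu n) hv) (ha n)).trans ?_
  gcongr
  exact hB n

theorem conv_form (h : 𝓔.IsClosedForm) {u w : ℕ → Lp ℝ 2 m} {a : Lp ℝ 2 m}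
    (hu : ∀ n, u n ∈ 𝓔.domain) (hv : v ∈ 𝓔.domain) (hc : 𝓔.Conv u v)
    (hw : ∀ n, w n ∈ 𝓔.domain) (ha : a ∈ 𝓔.domain) (hc' : 𝓔.Conv w a) :
    Tendsto (fun n => 𝓔.form (u n) (w n)) atTop (nhds (𝓔.form v a)) := by
  have h1 := h.conv_form_left hu hv hc (a := fun _ => a) (fun _ => ha) (fun _ => le_rfl)
  have h2 := h.conv_form_left hw ha hc' (a := fun _ => v) (fun _ => hv) (fun _ => le_rfl)
  have h4 := h.conv_form_zero hw ha hc'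
  obtain ⟨B, hB⟩ := h4.bddAbove_range
  have h3 := h.conv_form_left hu hv hc (a := fun n => w n - a) (fun n => h.sub_mem (hw n) ha)
    (fun n => hB ⟨n, rfl⟩)
  have h5 := ((h1.add h2).add h3).add_const (𝓔.form v a)
  simp only [add_zero, zero_add] at h5
  refine h5.congr fun n => ?_
  rw [h.form_sub_left (hu n) hv ha, h.form_sub_left (hw n) ha hv,
    h.form_sub_left (hu n) hv (h.sub_mem (hw n) ha), h.form_sub_right (hw n) ha (hu n),
    h.form_sub_right (hw n) ha hv, h.symm (w n) (hw n) v hv, h.symm a ha v hv]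
  ring

theorem conv_cauchy (h : 𝓔.IsClosedForm) {u : ℕ → Lp ℝ 2 m} (hu : ∀ n, u n ∈ 𝓔.domain)
    (hv : v ∈ 𝓔.domain) (hc : 𝓔.Conv u v) :
    ∀ ε > 0, ∃ N, ∀ p ≥ N, ∀ q ≥ N, 𝓔.energyOne (u p - u q) < ε := by
  intro ε hε
  obtain ⟨N, hN⟩ := eventually_atTop.1 ((tendsto_order.1 hc).2 (ε / 4) (by positivity))
  refine ⟨N, fun p hp q hq => ?_⟩
  have h1 := h.energyOne_sub_le (hu p) hv (hu q)
  rw [h.energyOne_sub_comm hv (hu q)] at h1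
  linarith [hN p hp, hN q hq]

/-! ### Closures in the energy norm and extensions of forms -/

theorem exists_seq_of_mem_closureIn (h : 𝓔.IsClosedForm) (hu : u ∈ 𝓔.closureIn C) :
    ∃ w : ℕ → Lp ℝ 2 m, (∀ n, w n ∈ 𝓔.domain ∧ ∃ f ∈ C, w n =ᵐ[m] f) ∧ 𝓔.Conv w u := by
  choose f hf w hw hwf hε using fun n : ℕ => hu.2 (1 / ((n : ℝ) + 1)) (by positivity)
  refine ⟨w, fun n => ⟨hw n, f n, hf n, hwf n⟩, ?_⟩
  refine squeeze_zero (fun n => h.energyOne_nonneg (h.sub_mem (hw n) hu.1)) (fun n => ?_)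
    tendsto_one_div_add_atTop_nhds_zero_nat
  rw [h.energyOne_sub_comm (hw n) hu.1]
  exact (hε n).le

theorem mem_closureIn_of_seq (h : 𝓔.IsClosedForm) (hu : u ∈ 𝓔.domain) {w : ℕ → Lp ℝ 2 m}
    (hw : ∀ n, w n ∈ 𝓔.closureIn C) (hc : 𝓔.Conv w u) : u ∈ 𝓔.closureIn C := by
  refine ⟨hu, fun ε hε => ?_⟩
  obtain ⟨n, hn⟩ := ((tendsto_order.1 hc).2 (ε / 4) (by positivity)).exists
  obtain ⟨f, hf, w', hw', hwf, hlt⟩ := (hw n).2 (ε / 4) (by positivity)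
  refine ⟨f, hf, w', hw', hwf, ?_⟩
  have h1 := h.energyOne_sub_le hu (hw n).1 hw'
  rw [h.energyOne_sub_comm hu (hw n).1] at h1
  linarith

theorem self_mem_closureIn (h : 𝓔.IsClosedForm) (hu : u ∈ 𝓔.domain) {f : X → ℝ} (hf : f ∈ C)
    (hfu : u =ᵐ[m] f) : u ∈ 𝓔.closureIn C :=
  ⟨hu, fun ε hε => ⟨f, hf, u, hu, hfu, by simpa [h.energyOne_zero] using hε⟩⟩

theorem closureIn_subset (h : 𝓔.IsClosedForm)
    (hC : ∀ f ∈ C, ∀ w ∈ 𝓔.domain, w =ᵐ[m] f → w ∈ 𝓔.closureIn C') :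
    𝓔.closureIn C ⊆ 𝓔.closureIn C' := by
  intro u hu
  obtain ⟨w, hw, hc⟩ := h.exists_seq_of_mem_closureIn hu
  refine h.mem_closureIn_of_seq hu.1 (fun n => ?_) hc
  obtain ⟨h1, f, hf, hwf⟩ := hw n
  exact hC f hf _ h1 hwf

theorem isClosedForm_closureForm (h : 𝓔.IsClosedForm) (hC : IsLinearSpace C)
    (hd : Dense (𝓔.closureIn C)) : (𝓔.closureForm C).IsClosedForm where
  zero_mem := h.self_mem_closureIn h.zero_mem hC.zero_mem (Lp.coeFn_zero _ _ _)
  add_mem u hu v hv := by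
    refine ⟨h.add_mem u hu.1 v hv.1, fun ε hε => ?_⟩
    obtain ⟨f, hf, w, hw, hwf, hlt⟩ := hu.2 (ε / 4) (by positivity)
    obtain ⟨f', hf', w', hw', hwf', hlt'⟩ := hv.2 (ε / 4) (by positivity)
    refine ⟨f + f', hC.add_mem f hf f' hf', w + w', h.add_mem w hw w' hw',
      (Lp.coeFn_add w w').trans (hwf.add hwf'), ?_⟩
    have h1 := h.energyOne_add_le (h.sub_mem hu.1 hw) (h.sub_mem hv.1 hw')
    rw [add_sub_add_comm]
    linarith
  smul_mem c u hu := by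
    obtain ⟨w, hw, hc⟩ := h.exists_seq_of_mem_closureIn hu
    refine h.mem_closureIn_of_seq (w := fun n => c • w n) (h.smul_mem c u hu.1) (fun n => ?_) ?_
    · obtain ⟨h1, f, hf, hwf⟩ := hw n
      exact h.self_mem_closureIn (h.smul_mem c _ h1) (hC.smul_mem c f hf)
        ((Lp.coeFn_smul c (w n)).trans (hwf.const_smul c))
    · have h1 := Tendsto.const_mul (c ^ 2) hc
      rw [mul_zero] at h1
      refine h1.congr fun n => ?_
      rw [← smul_sub, h.energyOne_smul c (h.sub_mem (hw n).1 hu.1)]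
  dense := hd
  symm u hu v hv := h.symm u hu.1 v hv.1
  add_left u hu v hv w hw := h.add_left u hu.1 v hv.1 w hw.1
  smul_left c u hu v hv := h.smul_left c u hu.1 v hv.1
  nonneg u hu := h.nonneg u hu.1
  complete u hu hC := by
    obtain ⟨v, hv, hc⟩ := h.complete u (fun n => (hu n).1) hC
    exact ⟨v, h.mem_closureIn_of_seq hv hu hc, hc⟩

/-- The sequence is Cauchy for `𝓔'`, hence for `𝓔`, where it has a limit by completeness; both
limits are limits in `L²` and so coincide. The forms need to agree only on the differences `w p - w
q`, so that neither has to extend the other. -/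
theorem mem_of_extends (h : 𝓔.IsClosedForm) (h' : 𝓔'.IsClosedForm) {w : ℕ → Lp ℝ 2 m}
    (hw : ∀ n, w n ∈ 𝓔.domain) (hw' : ∀ n, w n ∈ 𝓔'.domain)
    (heq : ∀ p q, 𝓔.form (w p - w q) (w p - w q) = 𝓔'.form (w p - w q) (w p - w q))
    (hu : u ∈ 𝓔'.domain) (hc : 𝓔'.Conv w u) : u ∈ 𝓔.domain ∧ 𝓔.Conv w u := by
  obtain ⟨v, hv, hcv⟩ := h.complete w hw (fun ε hε => by
    obtain ⟨N, hN⟩ := h'.conv_cauchy hw' hu hc ε hε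
    refine ⟨N, fun p hp q hq => ?_⟩
    have := hN p hp q hq
    rwa [energyOne, ← heq] at this)
  obtain rfl := tendsto_nhds_unique (h.conv_tendsto hw hv hcv) (h'.conv_tendsto hw' hu hc)
  exact ⟨hv, hcv⟩

/-- A closure does not depend on the closed form in which it is taken. This lets closures in the
form of `s` be computed in the maximal form of `s̄`. -/
theorem closureIn_eq_of_extends (h : 𝓔.IsClosedForm) (h' : 𝓔'.IsClosedForm)
    (he : 𝓔'.Extends 𝓔) (hC : ∀ f ∈ C, 𝓔.Mem f) : 𝓔'.closureIn C = 𝓔.closureIn C := by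
  ext u
  constructor
  · intro hu
    obtain ⟨w, hw, hc⟩ := h'.exists_seq_of_mem_closureIn hu
    have hw' : ∀ n, w n ∈ 𝓔.domain := fun n => by
      obtain ⟨-, f, hf, hwf⟩ := hw n
      obtain ⟨z, hz, hzf⟩ := hC f hf
      rwa [Lp.ext (hwf.trans hzf.symm)]
    obtain ⟨h1, h2⟩ := h.mem_of_extends h' hw' (fun n => (hw n).1)
      (fun p q => (he.2 _ (h.sub_mem (hw' p) (hw' q)) _ (h.sub_mem (hw' p) (hw' q))).symm) hu.1 hc
    refine h.mem_closureIn_of_seq h1 (fun n => ?_) h2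
    obtain ⟨-, f, hf, hwf⟩ := hw n
    exact h.self_mem_closureIn (hw' n) hf hwf
  · rintro ⟨hu, hu'⟩
    refine ⟨he.1 hu, fun ε hε => ?_⟩
    obtain ⟨f, hf, w, hw, hwf, hlt⟩ := hu' ε hε
    refine ⟨f, hf, w, he.1 hw, hwf, ?_⟩
    rwa [energyOne, he.2 _ (h.sub_mem hu hw) _ (h.sub_mem hu hw)]

theorem _root_.L2Form.extends_closureForm (𝓔 : L2Form m) (C : Set (X → ℝ)) :
    𝓔.Extends (𝓔.closureForm C) :=
  ⟨fun _ hu => hu.1, fun _ _ _ _ => rfl⟩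

/-- A closed form that is the restriction of a closed form `𝓔` to the closure of `C` is the
smallest closed extension of the restriction of `𝓔` to `C`. -/
theorem isSmallestClosedExtension (h : 𝓔.IsClosedForm) (h' : 𝓔'.IsClosedForm)
    (he : 𝓔.Extends 𝓔') (hC : IsLinearSpace C)
    (hd : 𝓔'.domain = 𝓔.closureIn C) :
    𝓔'.IsSmallestClosedExtension (𝓔.restrict C) := by
  have hsub : (𝓔.restrict C).domain ⊆ 𝓔'.domain := by
    rintro u ⟨hu, f, hf, hfu⟩
    rw [hd]
    exact h.self_mem_closureIn hu hf hfu
  have hrsub : ∀ u ∈ (𝓔.restrict C).domain, ∀ v ∈ (𝓔.restrict C).domain,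
      u - v ∈ (𝓔.restrict C).domain := by
    rintro u ⟨hu, f, hf, hfu⟩ v ⟨hv, g, hg, hgv⟩
    refine ⟨h.sub_mem hu hv, f + (-1 : ℝ) • g, hC.add_mem f hf _ (hC.smul_mem _ g hg), ?_⟩
    filter_upwards [Lp.coeFn_sub u v, hfu, hgv] with x h1 h2 h3
    rw [h1, Pi.sub_apply, h2, h3, Pi.add_apply, Pi.smul_apply, smul_eq_mul]
    ring
  refine ⟨h', ⟨hsub, fun u hu v hv => (he.2 u (hsub hu) v (hsub hv)).symm⟩, fun 𝓓 hD hDe => ?_⟩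
  -- The same approximating sequence converges to `u` in both `𝓔` and `𝓓`, so that values of `𝓓` and
  -- `𝓔` at the limits are limits of equal numbers.
  have key : ∀ u ∈ 𝓔'.domain, ∃ w : ℕ → Lp ℝ 2 m, (∀ n, w n ∈ (𝓔.restrict C).domain) ∧
      u ∈ 𝓓.domain ∧ 𝓓.Conv w u ∧ 𝓔.Conv w u := by
    intro u hu
    rw [hd] at hu
    obtain ⟨w, hw, hc⟩ := h.exists_seq_of_mem_closureIn hu
    have h1 := hD.mem_of_extends h (fun n => hDe.1 (hw n)) (fun n => (hw n).1)
      (fun p q => hDe.2 _ (hrsub _ (hw p) _ (hw q)) _ (hrsub _ (hw p) _ (hw q))) hu.1 hc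
    exact ⟨w, hw, h1.1, h1.2, hc⟩
  refine ⟨fun u hu => ?_, fun u hu v hv => ?_⟩
  · obtain ⟨w, -, h1, -⟩ := key u hu
    exact h1
  · obtain ⟨w, hw, hu1, hu2, hu3⟩ := key u hu
    obtain ⟨z, hz, hv1, hv2, hv3⟩ := key v hv
    rw [← he.2 u hu v hv]
    refine tendsto_nhds_unique (hD.conv_form (fun n => hDe.1 (hw n)) hu1 hu2
      (fun n => hDe.1 (hz n)) hv1 hv2) ((h.conv_form (fun n => (hw n).1) (he.1 hu) hu3
      (fun n => (hz n).1) (he.1 hv) hv3).congr fun n => ?_)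
    exact (hDe.2 _ (hw n) _ (hz n)).symm

/-- Closed forms are lower semicontinuous: the limit in `L²` of a sequence with bounded energy is
in the domain. -/
theorem mem_of_tendsto_of_form_le (h : 𝓔.IsClosedForm) {u : ℕ → Lp ℝ 2 m}
    (hu : ∀ n, u n ∈ 𝓔.domain) {B : ℝ} (hB : ∀ n, 𝓔.form (u n) (u n) ≤ B)
    (hc : Tendsto u atTop (nhds v)) : v ∈ 𝓔.domain ∧ 𝓔.form v v ≤ B := by
  -- Instead of weak compactness: `K n` is midpoint convex and shrinks to `v` in `L²`. Nearly
  -- energy-minimal elements `w n` of `K n` form a Cauchy sequence by the parallelogram law, and its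
  -- limit must be `v`.
  let K : ℕ → Set (Lp ℝ 2 m) := fun n =>
    {w | w ∈ 𝓔.domain ∧ ‖w - v‖ ≤ 1 / ((n : ℝ) + 1) ∧ 𝓔.form w w ≤ B}
  have hKne : ∀ n, (K n).Nonempty := fun n => by
    obtain ⟨k, hk⟩ := (hc.eventually (Metric.closedBall_mem_nhds v
      (show (0 : ℝ) < 1 / ((n : ℝ) + 1) by positivity))).exists
    exact ⟨u k, hu k, by simpa [dist_eq_norm] using hk, hB k⟩
  have hKmono : ∀ p q, p ≤ q → K q ⊆ K p := fun p q hpq w hw =>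
    ⟨hw.1, hw.2.1.trans (by gcongr), hw.2.2⟩
  have hpar : ∀ a ∈ 𝓔.domain, ∀ b ∈ 𝓔.domain,
      𝓔.form ((1 / 2 : ℝ) • (a + b)) ((1 / 2 : ℝ) • (a + b)) =
        (𝓔.form a a + 𝓔.form b b) / 2 - 𝓔.form (a - b) (a - b) / 4 := by
    intro a ha b hb
    rw [h.form_smul_self _ (h.add_mem a ha b hb), h.form_add_self ha hb, h.form_sub_self ha hb]
    ring
  have hKmid : ∀ n, ∀ a ∈ K n, ∀ b ∈ K n, (1 / 2 : ℝ) • (a + b) ∈ K n := by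
    rintro n a ⟨ha, ha1, ha2⟩ b ⟨hb, hb1, hb2⟩
    refine ⟨h.smul_mem _ _ (h.add_mem a ha b hb), ?_, ?_⟩
    · have : (1 / 2 : ℝ) • (a + b) - v = (1 / 2 : ℝ) • ((a - v) + (b - v)) := by module
      rw [this, norm_smul, Real.norm_eq_abs, abs_of_pos (by norm_num)]
      linarith [norm_add_le (a - v) (b - v)]
    · rw [hpar a ha b hb]
      linarith [h.nonneg _ (h.sub_mem ha hb)]
  let d : ℕ → ℝ := fun n => sInf ((fun w => 𝓔.form w w) '' K n)
  have hbdd : ∀ n, BddBelow ((fun w => 𝓔.form w w) '' K n) := fun n =>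
    ⟨0, by rintro _ ⟨w, hw, rfl⟩; exact h.nonneg w hw.1⟩
  have hdle : ∀ n, ∀ w ∈ K n, d n ≤ 𝓔.form w w := fun n w hw => csInf_le (hbdd n) ⟨w, hw, rfl⟩
  have hdmono : Monotone d := fun p q hpq =>
    csInf_le_csInf (hbdd p) ((hKne q).image _) (image_mono (hKmono p q hpq))
  have hdB : ∀ n, d n ≤ B := fun n => by
    obtain ⟨w, hw⟩ := hKne n
    exact (hdle n w hw).trans hw.2.2
  obtain ⟨l, hl⟩ : ∃ l, Tendsto d atTop (nhds l) :=
    ⟨_, tendsto_atTop_ciSup hdmono ⟨B, by rintro _ ⟨n, rfl⟩; exact hdB n⟩⟩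
  have hw : ∀ n : ℕ, ∃ w ∈ K n, 𝓔.form w w < d n + 1 / ((n : ℝ) + 1) := fun n => by
    obtain ⟨_, ⟨w, hw, rfl⟩, hlt⟩ := exists_lt_of_csInf_lt ((hKne n).image (fun w => 𝓔.form w w))
      (show sInf ((fun w => 𝓔.form w w) '' K n) < d n + 1 / ((n : ℝ) + 1) from
        lt_add_of_pos_right _ (by positivity))
    exact ⟨w, hw, hlt⟩
  choose w hwK hwd using hw
  have hdl : ∀ n, d n ≤ l := fun n => hdmono.ge_of_tendsto hl n
  have hwv : Tendsto w atTop (nhds v) := by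
    rw [tendsto_iff_norm_sub_tendsto_zero]
    exact squeeze_zero (fun n => norm_nonneg _) (fun n => (hwK n).2.1)
      tendsto_one_div_add_atTop_nhds_zero_nat
  -- The midpoint of `w p` and `w q` lies in `K N`, so its energy is at least `d N`, while `w p` and
  -- `w q` have energies below `l + 1/(N+1)`. The last summand is the square of the `L²`-diameter
  -- bound `2/(N+1)`.
  have hest : ∀ N p q, N ≤ p → N ≤ q → 𝓔.energyOne (w p - w q) ≤
      4 * (l - d N) + 4 * (1 / ((N : ℝ) + 1)) + 4 * (1 / ((N : ℝ) + 1)) ^ 2 := by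
    intro N p q hp hq
    have hpK := hKmono N p hp (hwK p)
    have hqK := hKmono N q hq (hwK q)
    have h1 := hdle N _ (hKmid N _ hpK _ hqK)
    rw [hpar _ hpK.1 _ hqK.1] at h1
    have hp1 : 1 / ((p : ℝ) + 1) ≤ 1 / ((N : ℝ) + 1) := by gcongr
    have hq1 : 1 / ((q : ℝ) + 1) ≤ 1 / ((N : ℝ) + 1) := by gcongr
    have h2 : ‖w p - w q‖ ^ 2 ≤ (2 * (1 / ((N : ℝ) + 1))) ^ 2 := by
      gcongr
      have : w p - w q = (w p - v) - (w q - v) := by abel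
      rw [this]
      linarith [norm_sub_le (w p - v) (w q - v), hpK.2.1, hqK.2.1]
    rw [energyOne]
    nlinarith [hwd p, hwd q, hdl p, hdl q]
  have hlim : Tendsto (fun N : ℕ => 4 * (l - d N) + 4 * (1 / ((N : ℝ) + 1)) +
      4 * (1 / ((N : ℝ) + 1)) ^ 2) atTop (nhds 0) := by
    have h1 := tendsto_one_div_add_atTop_nhds_zero_nat (𝕜 := ℝ)
    have h2 := (((hl.const_sub l).const_mul 4).add (h1.const_mul 4)).add ((h1.pow 2).const_mul 4)
    simpa using h2
  obtain ⟨z, hz, hcz⟩ := h.complete w (fun n => (hwK n).1) (fun ε hε => by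
    obtain ⟨N, hN⟩ := ((tendsto_order.1 hlim).2 ε hε).exists
    exact ⟨N, fun p hp q hq => (hest N p q hp hq).trans_lt hN⟩)
  obtain rfl := tendsto_nhds_unique (h.conv_tendsto (fun n => (hwK n).1) hz hcz) hwv
  refine ⟨hz, le_of_tendsto (h.conv_form (fun n => (hwK n).1) hz hcz (fun n => (hwK n).1) hz hcz)
    (Eventually.of_forall fun n => (hwK n).2.2)⟩

end IsClosedForm

end L2Form

end ClosedForms

/-! ### Smooth approximations of the unit contraction -/

section Contraction

/-- A smooth function that approximates the unit contraction up to `ε`. -/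
structure IsApproxContraction (ε : ℝ) (φ : ℝ → ℝ) : Prop where
  contDiff : ContDiff ℝ ∞ φ
  eq_self : ∀ t ∈ Icc (0 : ℝ) 1, φ t = t
  mem_Icc : ∀ t, -ε ≤ φ t ∧ φ t ≤ 1 + ε
  incr : ∀ t t', t < t' → 0 ≤ φ t' - φ t ∧ φ t' - φ t ≤ t' - t

namespace IsApproxContraction

variable {ε : ℝ} {φ : ℝ → ℝ}

theorem map_zero (h : IsApproxContraction ε φ) : φ 0 = 0 := h.eq_self 0 (by simp)

theorem abs_sub_le (h : IsApproxContraction ε φ) (t t' : ℝ) : |φ t - φ t'| ≤ |t - t'| := by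
  rcases lt_trichotomy t t' with hlt | rfl | hlt
  · rw [abs_sub_comm, abs_sub_comm t]
    have := h.incr t t' hlt
    rw [abs_of_nonneg this.1, abs_of_nonneg (by linarith)]
    exact this.2
  · simp
  · have := h.incr t' t hlt
    rw [abs_of_nonneg this.1, abs_of_nonneg (by linarith)]
    exact this.2

theorem abs_le (h : IsApproxContraction ε φ) (t : ℝ) : |φ t| ≤ |t| := by
  simpa [h.map_zero] using h.abs_sub_le t 0

theorem abs_sub_clamp_le (h : IsApproxContraction ε φ) (hε : 0 ≤ ε) (t : ℝ) :
    |φ t - min (max t 0) 1| ≤ ε := by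
  have h1 : φ 1 = 1 := h.eq_self 1 (by simp)
  rcases lt_or_ge t 0 with ht | ht
  · rw [max_eq_right ht.le, min_eq_left zero_le_one]
    have := h.incr t 0 ht
    rw [h.map_zero] at this
    have := h.mem_Icc t
    rw [abs_le']
    constructor <;> linarith
  · rw [max_eq_left ht]
    rcases le_or_gt t 1 with ht' | ht'
    · rw [min_eq_left ht', h.eq_self t ⟨ht, ht'⟩]
      simpa using hε
    · rw [min_eq_right ht'.le]
      have := h.incr 1 t ht'
      rw [h1] at this
      have := h.mem_Icc t
      rw [abs_le']
      constructor <;> linarith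

theorem abs_deriv_le (h : IsApproxContraction ε φ) (t : ℝ) : |deriv φ t| ≤ 1 := by
  have : LipschitzWith 1 φ := LipschitzWith.of_dist_le_mul fun x y => by
    simpa [Real.dist_eq] using h.abs_sub_le x y
  simpa using norm_deriv_le_of_lipschitz (x₀ := t) this

end IsApproxContraction

theorem hasDerivAt_integral_of_continuous {F : ℝ → ℝ} (hF : Continuous F) (a t : ℝ) :
    HasDerivAt (fun u => ∫ x in a..u, F x) (F t) t :=
  intervalIntegral.integral_hasDerivAt_right (hF.intervalIntegrable _ _)
    (hF.stronglyMeasurableAtFilter _ _) hF.continuousAt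

theorem contDiff_integral {F : ℝ → ℝ} (hF : ContDiff ℝ ∞ F) (a : ℝ) :
    ContDiff ℝ ∞ (fun u => ∫ x in a..u, F x) := by
  rw [contDiff_infty_iff_deriv]
  have h := hasDerivAt_integral_of_continuous hF.continuous a
  refine ⟨fun t => (h t).differentiableAt, ?_⟩
  rwa [show deriv (fun u => ∫ x in a..u, F x) = F from funext fun t => (h t).deriv]

/-- The primitive from `0` of a smooth bump with values in `[0, 1]` that is `1` on `[0, 1]` and
vanishes off `[-ε, 1 + ε]`: the slope bounds give the increments, and the support bounds the range.
-/
theorem exists_isApproxContraction {ε : ℝ} (hε : 0 < ε) : ∃ φ, IsApproxContraction ε φ := by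
  let χ : ContDiffBump (1 / 2 : ℝ) := ⟨1 / 2, 1 / 2 + ε, by norm_num, by linarith⟩
  have hχ : ContDiff ℝ ∞ χ := χ.contDiff
  have hi : ∀ a b, IntervalIntegrable χ volume a b := fun a b =>
    hχ.continuous.intervalIntegrable a b
  have hincr : ∀ t t', t ≤ t' → 0 ≤ (∫ x in t..t', χ x) ∧ (∫ x in t..t', χ x) ≤ t' - t := by
    intro t t' htt'
    refine ⟨intervalIntegral.integral_nonneg htt' fun x _ => χ.nonneg, ?_⟩
    have := intervalIntegral.integral_mono_on htt' (hi t t') intervalIntegrable_const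
      (fun x _ => χ.le_one (x := x))
    simpa using this
  have hone : ∀ x ∈ Icc (0 : ℝ) 1, χ x = 1 := fun x hx =>
    χ.one_of_mem_closedBall (by
      rw [Real.closedBall_eq_Icc]
      constructor <;> simp only [χ] <;> linarith [hx.1, hx.2])
  have hzero : ∀ x, x ∉ Icc (-ε) (1 + ε) → χ x = 0 := fun x hx =>
    χ.zero_of_le_dist (by
      rw [Real.dist_eq]
      by_contra hlt
      apply hx
      rw [not_le, abs_lt] at hlt
      simp only [χ] at hlt
      constructor <;> linarith [hlt.1, hlt.2])
  have hsub : ∀ t t', (∫ x in (0 : ℝ)..t', χ x) - ∫ x in (0 : ℝ)..t, χ x = ∫ x in t..t', χ x :=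
    fun t t' => intervalIntegral.integral_interval_sub_left (hi _ _) (hi _ _)
  have hself : ∀ t ∈ Icc (0 : ℝ) 1, ∫ x in (0 : ℝ)..t, χ x = t := by
    intro t ht
    rw [intervalIntegral.integral_congr (g := fun _ => (1 : ℝ))]
    · simp
    · intro x hx
      rw [uIcc_of_le ht.1] at hx
      exact hone x ⟨hx.1, hx.2.trans ht.2⟩
  have hincr' : ∀ t t', t ≤ t' → 0 ≤ (∫ x in (0 : ℝ)..t', χ x) - (∫ x in (0 : ℝ)..t, χ x) ∧
      (∫ x in (0 : ℝ)..t', χ x) - (∫ x in (0 : ℝ)..t, χ x) ≤ t' - t := fun t t' h => by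
    rw [hsub]; exact hincr t t' h
  refine ⟨fun t => ∫ x in (0 : ℝ)..t, χ x, contDiff_integral hχ 0, hself, fun t => ?_,
    fun t t' h => hincr' t t' h.le⟩
  have h0 := hself 0 (by simp)
  have h1 := hself 1 (by simp)
  constructor
  · rcases le_or_gt (-ε) t with ht | ht
    · rcases le_or_gt t 0 with ht0 | ht0
      · have := hincr' t 0 ht0
        linarith
      · have := hincr' 0 t ht0.le
        linarith
    · have h2 : ∫ x in t..(-ε), χ x = 0 := by
        rw [intervalIntegral.integral_of_le ht.le, integral_Ioc_eq_integral_Ioo]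
        refine setIntegral_eq_zero_of_forall_eq_zero fun x hx => hzero x fun h => ?_
        linarith [hx.2, h.1]
      rw [← hsub] at h2
      have := hincr' (-ε) 0 (by linarith)
      linarith
  · rcases le_or_gt t (1 + ε) with ht | ht
    · rcases le_or_gt 1 t with ht0 | ht0
      · have := hincr' 1 t ht0
        linarith
      · have := hincr' t 1 ht0.le
        linarith
    · have h2 : ∫ x in (1 + ε)..t, χ x = 0 := by
        rw [intervalIntegral.integral_of_le ht.le]
        refine setIntegral_eq_zero_of_forall_eq_zero fun x hx => hzero x fun h => ?_
        linarith [hx.1, h.2]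
      rw [← hsub] at h2
      have := hincr' 1 (1 + ε) (by linarith)
      linarith

/-! ### Contractions operating on closures -/

theorem Lp_norm_sq_eq_integral {X : Type*} [MeasurableSpace X] {m : Measure X} (f : Lp ℝ 2 m) :
    ‖f‖ ^ 2 = ∫ x, f x ^ 2 ∂m := by
  rw [← real_inner_self_eq_norm_sq, L2.inner_def]
  refine integral_congr_ae (Eventually.of_forall fun x => ?_)
  simp [pow_two]

variable {X : Type*} [MeasurableSpace X] {m : Measure X}

theorem memLp_comp_of_abs_le {φ : ℝ → ℝ} (hφ : Continuous φ) (h : ∀ t, |φ t| ≤ |t|)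
    (u : Lp ℝ 2 m) : MemLp (fun x => φ (u x)) 2 m :=
  (Lp.memLp u).mono (hφ.comp_aestronglyMeasurable (Lp.aestronglyMeasurable u))
    (Eventually.of_forall fun x => h (u x))

/-- Dominated convergence: the integrand is pointwise at most `ε n ^ 2` and is dominated by `4 u²`,
since both contractions are bounded by `|u|`. -/
theorem tendsto_approxContraction {ε : ℕ → ℝ} (hε : Tendsto ε atTop (nhds 0))
    (hε0 : ∀ n, 0 ≤ ε n) {φ : ℕ → ℝ → ℝ} (hφ : ∀ n, IsApproxContraction (ε n) (φ n))
    {u v : Lp ℝ 2 m} (hv : v =ᵐ[m] fun x => min (max (u x) 0) 1) :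
    Tendsto (fun n => (memLp_comp_of_abs_le (hφ n).contDiff.continuous (hφ n).abs_le u).toLp _)
      atTop (nhds v) := by
  set a := fun n => (memLp_comp_of_abs_le (hφ n).contDiff.continuous (hφ n).abs_le u).toLp _
  have ha : ∀ n, a n =ᵐ[m] fun x => φ n (u x) := fun n => MemLp.coeFn_toLp _
  rw [tendsto_iff_norm_sub_tendsto_zero]
  have hclamp : ∀ t : ℝ, |min (max t 0) 1| ≤ |t| := fun t => by
    rw [abs_of_nonneg (le_min (le_max_right _ _) zero_le_one)]
    exact (min_le_left _ _).trans (max_le (le_abs_self t) (abs_nonneg t))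
  have hdiff : ∀ n, (a n - v : Lp ℝ 2 m) =ᵐ[m]
      fun x => φ n (u x) - min (max (u x) 0) 1 := fun n => by
    filter_upwards [Lp.coeFn_sub (a n) v, ha n, hv] with x h1 h2 h3
    rw [h1, Pi.sub_apply, h2, h3]
  have h2 : Tendsto (fun n => ‖a n - v‖ ^ 2) atTop (nhds 0) := by
    simp_rw [Lp_norm_sq_eq_integral]
    have := tendsto_integral_of_dominated_convergence (μ := m)
      (F := fun n x => (a n - v : Lp ℝ 2 m) x ^ 2) (f := fun _ => (0 : ℝ))
      (fun x => 4 * u x ^ 2)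
      (fun n => (Lp.aestronglyMeasurable _).pow 2) ((Lp.memLp u).integrable_sq.const_mul 4)
      (fun n => by
        filter_upwards [hdiff n] with x hx
        rw [hx, Real.norm_eq_abs, abs_of_nonneg (sq_nonneg _), ← sq_abs (_ - _), ← sq_abs (u x)]
        have h1 := abs_sub (φ n (u x)) (min (max (u x) 0) 1)
        have h2 := (hφ n).abs_le (u x)
        have h3 := hclamp (u x)
        nlinarith [abs_nonneg (φ n (u x) - min (max (u x) 0) 1)])
      (by
        filter_upwards [ae_all_iff.2 hdiff] with x hx
        simp_rw [hx]
        have h1 : Tendsto (fun n => φ n (u x) - min (max (u x) 0) 1) atTop (nhds 0) :=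
          squeeze_zero_norm (fun n => (hφ n).abs_sub_clamp_le (hε0 n) (u x)) hε
        simpa using h1.pow 2)
    simpa using this
  simpa using h2.sqrt

namespace L2Form

variable {𝓔 : L2Form m} {C : Set (X → ℝ)}

/-- If `f n ∈ C` approximate `u`, then `φ n ∘ f n` tend to the unit contraction of `u` in `L²`, with
energies at most those of `f n`; lower semicontinuity gives the rest. Only the energy inequality on
`C` has to be checked in an application. -/
theorem IsClosedForm.isDirichletForm_closureForm (h : 𝓔.IsClosedForm) (hC : IsLinearSpace C)
    (hd : Dense (𝓔.closureIn C)) (hmem : ∀ f ∈ C, 𝓔.Mem f)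
    (hcontr : ∀ ε φ, IsApproxContraction ε φ → ∀ f ∈ C, φ ∘ f ∈ C ∧
      ∀ u ∈ 𝓔.domain, ∀ w ∈ 𝓔.domain, u =ᵐ[m] f → w =ᵐ[m] φ ∘ f → 𝓔.form w w ≤ 𝓔.form u u) :
    (𝓔.closureForm C).IsDirichletForm where
  toIsClosedForm := h.isClosedForm_closureForm hC hd
  unit_contraction u hu v hv := by
    have h' := h.isClosedForm_closureForm hC hd
    obtain ⟨w, hw, hc⟩ := h.exists_seq_of_mem_closureIn hu
    choose hwd f hf hwf using hw
    choose φ hφ using fun n : ℕ =>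
      exists_isApproxContraction (show (0 : ℝ) < 1 / ((n : ℝ) + 1) by positivity)
    choose z hz hzf using fun n => hmem _ (hcontr _ _ (hφ n) (f n) (hf n)).1
    have hle : ∀ n, 𝓔.form (z n) (z n) ≤ 𝓔.form (w n) (w n) := fun n =>
      (hcontr _ _ (hφ n) (f n) (hf n)).2 _ (hwd n) _ (hz n) (hwf n) (hzf n)
    have hzC : ∀ n, z n ∈ (𝓔.closureForm C).domain := fun n =>
      h.self_mem_closureIn (hz n) (hcontr _ _ (hφ n) (f n) (hf n)).1 (hzf n)
    have hlim := h.conv_form hwd hu.1 hc hwd hu.1 hc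
    have hzv : Tendsto z atTop (nhds v) := by
      have h1 := tendsto_approxContraction tendsto_one_div_add_atTop_nhds_zero_nat
        (fun n => by positivity) hφ hv
      have h2 := h.conv_tendsto hwd hu.1 hc
      rw [tendsto_iff_norm_sub_tendsto_zero] at h1 h2 ⊢
      -- Passing through `φ n ∘ u`: the first distance is at most `‖w n - u‖`, as `φ n` is
      -- 1-Lipschitz.
      refine squeeze_zero (fun n => norm_nonneg _) (fun n => ?_) (by simpa using h2.add h1)
      refine (norm_sub_le_norm_sub_add_norm_sub _ _ _).trans (add_le_add_left ?_ _)
      refine Lp.norm_le_norm_of_ae_le ?_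
      filter_upwards [Lp.coeFn_sub (z n) ((memLp_comp_of_abs_le (hφ n).contDiff.continuous
        (hφ n).abs_le u).toLp _), Lp.coeFn_sub (w n) u, hzf n, hwf n, MemLp.coeFn_toLp
        (memLp_comp_of_abs_le (hφ n).contDiff.continuous (hφ n).abs_le u)] with x h1 h2 h3 h4 h5
      rw [h1, h2, Pi.sub_apply, Pi.sub_apply, h3, h5, h4]
      exact (hφ n).abs_sub_le _ _
    -- The energies of the tail of `z` are below `𝓔(u, u) + δ`; the slack `δ` disappears at the end.
    have key : ∀ δ > 0, v ∈ (𝓔.closureForm C).domain ∧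
        (𝓔.closureForm C).form v v ≤ 𝓔.form u u + δ := by
      intro δ hδ
      obtain ⟨N, hN⟩ := eventually_atTop.1
        ((tendsto_order.1 hlim).2 (𝓔.form u u + δ) (by linarith))
      exact h'.mem_of_tendsto_of_form_le (u := fun n => z (n + N)) (fun n => hzC _)
        (fun n => (hle _).trans (hN _ (Nat.le_add_left _ _)).le) ((tendsto_add_atTop_iff_nat N).2 hzv)
    exact ⟨(key 1 one_pos).1, le_of_forall_pos_le_add fun δ hδ => (key δ hδ).2⟩

end L2Form

end Contraction

/-! ### Coordinates on an open interval -/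

section Coord

open Topology

variable {I : Set ℝ}

/-- A coordinate on the open set `I`: a strictly increasing continuous function. -/
structure IsCoord (t : I → ℝ) : Prop where
  isOpen : IsOpen I
  strictMono : StrictMono t
  continuous : Continuous t

theorem IsScale.isCoord {e : I} {s : I → ℝ} (hs : IsScale e s) (hI : IsOpen I) : IsCoord s :=
  ⟨hI, hs.strictMono, hs.continuous⟩

theorem isCoord_val (hI : IsOpen I) : IsCoord (Subtype.val : I → ℝ) :=
  ⟨hI, fun _ _ h => h, continuous_subtype_val⟩

/-- With the inclusion as a coordinate, `C_c^∞(I)` and `C_c^∞ ∘ s` become instances of one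
construction, as do `λ_I` and `ds`. -/
theorem testFunOn_eq (I : Set ℝ) : testFunOn I = testFunComp (Subtype.val : I → ℝ) := by
  simp only [testFunOn, testFunComp, Subtype.range_coe]
  rfl

theorem lebesgueOn_eq (I : Set ℝ) : lebesgueOn I = scaleMeasure (Subtype.val : I → ℝ) := rfl

theorem isCompact_Icc_subtype [I.OrdConnected] (a b : I) : IsCompact (Icc a b) := by
  rw [Subtype.isCompact_iff]
  have : Subtype.val '' Icc a b = Icc (a : ℝ) b := by
    ext x
    constructor
    · rintro ⟨y, hy, rfl⟩
      exact hy
    · intro hx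
      exact ⟨⟨x, Set.OrdConnected.out ‹_› a.2 b.2 hx⟩, hx, rfl⟩
  rw [this]
  exact isCompact_Icc

namespace IsCoord

variable {t : I → ℝ}

theorem exists_lt (h : IsCoord t) (x : I) : ∃ y, y < x := by
  obtain ⟨ε, hε, hball⟩ := Metric.isOpen_iff.1 h.isOpen x x.2
  have : (x : ℝ) - ε / 2 ∈ I := hball (by
    rw [Metric.mem_ball, Real.dist_eq, abs_lt]; constructor <;> linarith)
  exact ⟨⟨_, this⟩, Subtype.coe_lt_coe.1 (by dsimp only; linarith)⟩

theorem exists_gt (h : IsCoord t) (x : I) : ∃ y, x < y := by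
  obtain ⟨ε, hε, hball⟩ := Metric.isOpen_iff.1 h.isOpen x x.2
  have : (x : ℝ) + ε / 2 ∈ I := hball (by
    rw [Metric.mem_ball, Real.dist_eq, abs_lt]; constructor <;> linarith)
  exact ⟨⟨_, this⟩, Subtype.coe_lt_coe.1 (by dsimp only; linarith)⟩

variable [I.OrdConnected]

theorem ordConnected_range (h : IsCoord t) : (range t).OrdConnected := by
  have : PreconnectedSpace I := Subtype.preconnectedSpace (‹I.OrdConnected›).isPreconnected
  exact (isPreconnected_range h.continuous).ordConnected

theorem isOpen_range (h : IsCoord t) : IsOpen (range t) := by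
  rw [isOpen_iff_mem_nhds]
  rintro _ ⟨x, rfl⟩
  obtain ⟨a, ha⟩ := h.exists_lt x
  obtain ⟨b, hb⟩ := h.exists_gt x
  exact mem_of_superset (Icc_mem_nhds (h.strictMono ha) (h.strictMono hb))
    (h.ordConnected_range.out ⟨a, rfl⟩ ⟨b, rfl⟩)

theorem isOpenEmbedding (h : IsCoord t) : IsOpenEmbedding t :=
  ⟨h.strictMono.isEmbedding_of_ordConnected h.ordConnected_range, h.isOpen_range⟩

theorem measurableEmbedding (h : IsCoord t) : MeasurableEmbedding t :=
  h.isOpenEmbedding.measurableEmbedding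

theorem Ioc_subset_range (h : IsCoord t) (x y : I) : Ioc (t x) (t y) ⊆ range t :=
  Ioc_subset_Icc_self.trans (h.ordConnected_range.out ⟨x, rfl⟩ ⟨y, rfl⟩)

theorem preimage_Ioc (h : IsCoord t) (x y : I) : t ⁻¹' Ioc (t x) (t y) = Ioc x y := by
  ext z
  simp [h.strictMono.lt_iff_lt, h.strictMono.le_iff_le]

theorem image_Ioc (h : IsCoord t) (x y : I) : t '' Ioc x y = Ioc (t x) (t y) := by
  rw [← h.preimage_Ioc, image_preimage_eq_of_subset (h.Ioc_subset_range x y)]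

theorem scaleMeasure_Ioc (h : IsCoord t) (x y : I) :
    scaleMeasure t (Ioc x y) = ENNReal.ofReal (t y - t x) := by
  rw [scaleMeasure, h.measurableEmbedding.comap_apply, h.image_Ioc, Real.volume_Ioc]

theorem scaleMeasure_Ioc_lt_top (h : IsCoord t) (x y : I) : scaleMeasure t (Ioc x y) < ⊤ := by
  rw [h.scaleMeasure_Ioc]; exact ENNReal.ofReal_lt_top

theorem exists_Ioo_mem (h : IsCoord t) (x : I) : ∃ a b, x ∈ Ioo a b := by
  obtain ⟨a, ha⟩ := h.exists_lt x
  obtain ⟨b, hb⟩ := h.exists_gt x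
  exact ⟨a, b, ha, hb⟩

theorem isLocallyFiniteMeasure (h : IsCoord t) : IsLocallyFiniteMeasure (scaleMeasure t) :=
  ⟨fun x => by
    obtain ⟨a, b, hab⟩ := h.exists_Ioo_mem x
    exact ⟨Ioc a b, mem_of_superset (Ioo_mem_nhds hab.1 hab.2) Ioo_subset_Ioc_self,
      h.scaleMeasure_Ioc_lt_top a b⟩⟩

theorem locallyCompactSpace (h : IsCoord t) : LocallyCompactSpace I := h.isOpen.locallyCompactSpace

theorem exists_subset_Ioo (h : IsCoord t) (e : I) {K : Set I} (hK : IsCompact K) :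
    ∃ a b, a < b ∧ K ⊆ Ioo a b := by
  have : Nonempty I := ⟨e⟩
  obtain ⟨a, ha⟩ := hK.bddBelow
  obtain ⟨b, hb⟩ := hK.bddAbove
  obtain ⟨a', ha'⟩ := h.exists_lt (min a b)
  obtain ⟨b', hb'⟩ := h.exists_gt b
  exact ⟨a', b', (ha'.trans_le (min_le_right _ _)).trans hb',
    fun x hx => ⟨(ha'.trans_le (min_le_left _ _)).trans_le (ha hx), (hb hx).trans_lt hb'⟩⟩

/-- Change of variables. -/
theorem setIntegral_comp (h : IsCoord t) (F : ℝ → ℝ) (x y : I) :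
    ∫ z in Ioc x y, F (t z) ∂(scaleMeasure t) = ∫ z in Ioc (t x) (t y), F z := by
  have h1 := h.measurableEmbedding.setIntegral_map (μ := scaleMeasure t) F (Ioc (t x) (t y))
  rw [h.preimage_Ioc, scaleMeasure, h.measurableEmbedding.map_comap, Measure.restrict_restrict
    measurableSet_Ioc, inter_eq_left.2 (h.Ioc_subset_range x y)] at h1
  exact h1.symm

/-- Continuous functions with compact support are uniformly approximated by test functions,
without increasing the set where they do not vanish. -/
theorem exists_testFun_abs_sub_lt (h : IsCoord t) {f : I → ℝ} (hf : Continuous f)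
    (hfc : HasCompactSupport f) {ε : ℝ} (hε : 0 < ε) :
    ∃ φ ∈ testFun (range t), (∀ x, |f x - φ (t x)| < ε) ∧ ∀ x, f x = 0 → φ (t x) = 0 := by
  set H : ℝ → ℝ := Function.extend t f 0
  have hHt : ∀ x, H (t x) = f x := h.strictMono.injective.extend_apply f 0
  have hts : tsupport H = t '' tsupport f :=
    hfc.tsupport_extend_zero h.continuous h.strictMono.injective
  have hH : Continuous H := by
    refine continuous_of_tsupport fun x hx => ?_
    rw [hts] at hx
    obtain ⟨y, -, rfl⟩ := hx
    rw [← h.isOpenEmbedding.continuousAt_iff,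
      show H ∘ t = f from funext hHt]
    exact hf.continuousAt
  -- Smooth approximation on `ℝ` of the extension by zero, with support inside that of `H`; this
  -- keeps `φ` inside the open range of `t`.
  obtain ⟨φ, hφ, hφH, hsupp⟩ := hH.exists_contDiff_approx ⊤ (ε := fun _ => ε) continuous_const
    (fun _ => hε)
  have hsub : tsupport φ ⊆ t '' tsupport f := hts ▸ closure_mono hsupp
  have hcomp : IsCompact (t '' tsupport f) := IsCompact.image hfc h.continuous
  refine ⟨φ, ⟨hφ, HasCompactSupport.of_support_subset_isCompact hcomp
    ((subset_tsupport _).trans hsub), hsub.trans (image_subset_range _ _)⟩, fun x => ?_,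
    fun x hx => ?_⟩
  · have := hφH (t x)
    rwa [hHt, dist_comm, Real.dist_eq] at this
  · by_contra hne
    exact hsupp (show t x ∈ Function.support φ from hne) ((hHt x).trans hx)

theorem hasCompactSupport_comp (h : IsCoord t) {φ : ℝ → ℝ} (hφ : φ ∈ testFun (range t)) :
    HasCompactSupport (φ ∘ t) := by
  refine HasCompactSupport.of_support_subset_isCompact
    (h.isOpenEmbedding.isInducing.isCompact_preimage' hφ.2.1 hφ.2.2) fun x hx => ?_
  exact subset_tsupport φ hx

theorem _root_.isLinearSpace_testFunComp (t : I → ℝ) : IsLinearSpace (testFunComp t) where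
  zero_mem := ⟨0, ⟨contDiff_const, HasCompactSupport.zero, by simp⟩, rfl⟩
  add_mem := by
    rintro _ ⟨φ, hφ, rfl⟩ _ ⟨ψ, hψ, rfl⟩
    exact ⟨φ + ψ, ⟨hφ.1.add hψ.1, hφ.2.1.add hψ.2.1,
      (tsupport_add φ ψ).trans (union_subset hφ.2.2 hψ.2.2)⟩, rfl⟩
  smul_mem := by
    rintro c _ ⟨φ, hφ, rfl⟩
    exact ⟨c • φ, ⟨hφ.1.const_smul c, hφ.2.1.smul_left (f := fun _ => c),
      (tsupport_smul_subset_right (fun _ => c) φ).trans hφ.2.2⟩, rfl⟩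

theorem _root_.mul_mem_testFunComp {f g : I → ℝ} (hf : f ∈ testFunComp t) (hg : g ∈ testFunComp t) :
    f * g ∈ testFunComp t := by
  obtain ⟨φ, hφ, rfl⟩ := hf
  obtain ⟨ψ, hψ, rfl⟩ := hg
  exact ⟨φ * ψ, ⟨hφ.1.mul hψ.1, hφ.2.1.mul_right, (tsupport_mul_subset_left).trans hφ.2.2⟩, rfl⟩

theorem _root_.comp_mem_testFun {U : Set ℝ} {φ η : ℝ → ℝ} (hφ : φ ∈ testFun U) (hη : ContDiff ℝ ∞ η)
    (hη0 : η 0 = 0) : η ∘ φ ∈ testFun U :=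
  ⟨hη.comp hφ.1, hφ.2.1.comp_left hη0, (closure_mono (Function.support_comp_subset hη0 φ)).trans hφ.2.2⟩

theorem exists_cutoff (h : IsCoord t) {K G : Set I} (hK : IsCompact K) (hG : IsOpen G)
    (hKG : K ⊆ G) :
    ∃ φ ∈ testFun (range t), (∀ x, φ x ∈ Icc (0 : ℝ) 1) ∧ (∀ x ∈ K, φ (t x) = 1) ∧
      ∀ x ∉ G, φ (t x) = 0 := by
  have hK' : IsCompact (t '' K) := hK.image h.continuous
  have hG' : IsOpen (t '' G) := h.isOpenEmbedding.isOpenMap G hG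
  obtain ⟨L, hL, hKL, hLG⟩ := exists_compact_between hK' hG' (image_mono hKG)
  obtain ⟨φ, hφ1, hφ0, hφ⟩ := exists_contMDiffMap_one_nhds_of_subset_interior (n := ⊤)
    (modelWithCornersSelf ℝ ℝ) hK'.isClosed hKL
  have hsupp : Function.support φ ⊆ L := fun x hx => by
    by_contra hxL
    exact hx (hφ0 x hxL)
  refine ⟨φ, ⟨φ.contMDiff.contDiff, HasCompactSupport.of_support_subset_isCompact hL hsupp,
    (closure_minimal hsupp hL.isClosed).trans (hLG.trans (image_subset_range _ _))⟩, hφ,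
    fun x hx => hφ1.self_of_nhdsSet _ ⟨x, hx, rfl⟩, fun x hx => hφ0 _ fun hxL => hx ?_⟩
  obtain ⟨y, hy, hyx⟩ := hLG hxL
  rwa [← h.strictMono.injective hyx]

theorem memLp_testFun_comp (h : IsCoord t) {m : Measure I} [IsFiniteMeasureOnCompacts m]
    {φ : ℝ → ℝ} (hφ : φ ∈ testFun (range t)) : MemLp (φ ∘ t) 2 m :=
  (hφ.1.continuous.comp h.continuous).memLp_of_hasCompactSupport (h.hasCompactSupport_comp hφ)

/-- Uniform approximation of `f` by test functions implies approximation in `L²`. -/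
theorem exists_testFun_eLpNorm_sub_le_of_continuous (h : IsCoord t) (m : Measure I)
    [IsFiniteMeasureOnCompacts m] {f : I → ℝ} (hf : Continuous f) (hfc : HasCompactSupport f)
    {δ : ℝ≥0∞} (hδ : δ ≠ 0) :
    ∃ φ ∈ testFun (range t), eLpNorm (f - φ ∘ t) 2 m ≤ δ ∧ ∀ x, f x = 0 → φ (t x) = 0 := by
  have hK : m (tsupport f) < ⊤ := IsCompact.measure_lt_top hfc
  have hlim : Tendsto (fun c : ℝ => ENNReal.ofReal c * m (tsupport f) ^ (1 / (2 : ℝ≥0∞).toReal))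
      (𝓝[>] 0) (𝓝 0) := by
    have h1 : Tendsto (fun c : ℝ => ENNReal.ofReal c) (𝓝[>] 0) (𝓝 0) := by
      have := (ENNReal.continuous_ofReal.tendsto 0).mono_left (nhdsWithin_le_nhds (s := Ioi 0))
      simpa using this
    have := ENNReal.Tendsto.mul_const (b := m (tsupport f) ^ (1 / (2 : ℝ≥0∞).toReal)) h1
      (Or.inr (ENNReal.rpow_ne_top_of_nonneg (by simp) hK.ne))
    simpa using this
  obtain ⟨c, hc, hc0⟩ := (((tendsto_order.1 hlim).2 δ (pos_iff_ne_zero.2 hδ)).and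
    self_mem_nhdsWithin).exists
  obtain ⟨φ, hφ, hφf, hφ0⟩ := h.exists_testFun_abs_sub_lt hf hfc hc0
  refine ⟨φ, hφ, (eLpNorm_sub_le_of_dist_bdd m (by simp) (isClosed_tsupport f).measurableSet
    (le_of_lt hc0) (fun x => (hφf x).le) (subset_tsupport f) fun x hx => ?_).trans hc.le, hφ0⟩
  exact subset_tsupport f (show x ∈ Function.support f from fun h0 => hx (hφ0 x h0))

theorem regular (h : IsCoord t) (m : Measure I) [IsFiniteMeasureOnCompacts m] : m.Regular := by
  have := h.locallyCompactSpace
  infer_instance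

theorem exists_testFun_eLpNorm_sub_le (h : IsCoord t) (m : Measure I)
    [IsFiniteMeasureOnCompacts m] {f : I → ℝ} (hf : MemLp f 2 m) {δ : ℝ≥0∞} (hδ : δ ≠ 0) :
    ∃ φ ∈ testFun (range t), eLpNorm (f - φ ∘ t) 2 m ≤ δ := by
  have := h.locallyCompactSpace
  have := h.regular m
  have hδ2 : δ / 2 ≠ 0 := by simpa using hδ
  obtain ⟨g, hgc, hfg, hg, hgm⟩ := hf.exists_hasCompactSupport_eLpNorm_sub_le (by simp) hδ2
  obtain ⟨φ, hφ, hφg, -⟩ := h.exists_testFun_eLpNorm_sub_le_of_continuous m hg hgc hδ2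
  refine ⟨φ, hφ, ?_⟩
  rw [show f - φ ∘ t = (f - g) + (g - φ ∘ t) by abel]
  refine (eLpNorm_add_le (hf.sub hgm).1 (hgm.sub (h.memLp_testFun_comp hφ)).1 (by simp)).trans ?_
  exact (add_le_add hfg hφg).trans (ENNReal.add_halves δ).le

/-- Approximation in `L²` of a function that vanishes off a compact set `K`, by test functions
that vanish off a neighbourhood of `K`. -/
theorem exists_testFun_eLpNorm_sub_le_of_subset (h : IsCoord t) (m : Measure I)
    [IsFiniteMeasureOnCompacts m] {f : I → ℝ} (hf : MemLp f 2 m) {K U : Set I} (hK : IsCompact K)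
    (hU : IsOpen U) (hKU : K ⊆ U) (hfK : ∀ x ∉ K, f x = 0) {δ : ℝ≥0∞} (hδ : δ ≠ 0) :
    ∃ φ ∈ testFun (range t), eLpNorm (f - φ ∘ t) 2 m ≤ δ ∧ ∀ x ∉ U, φ (t x) = 0 := by
  have := h.locallyCompactSpace
  have := h.regular m
  have hδ2 : δ / 2 ≠ 0 := by simpa using hδ
  obtain ⟨g, hgc, hfg, hg, hgm⟩ := hf.exists_hasCompactSupport_eLpNorm_sub_le (by simp) hδ2
  obtain ⟨χ, hχt, hχ, hχ1, hχ0⟩ := h.exists_cutoff hK hU hKU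
  have hχc : Continuous (χ ∘ t) := hχt.1.continuous.comp h.continuous
  -- Cutting `g` off does not increase its distance to `f`: on `K` the cut-off is `1`, and off `K`,
  -- where `f = 0`, it only shrinks `g`.
  have hfχ : eLpNorm (f - (χ ∘ t) * g) 2 m ≤ δ / 2 := by
    refine (eLpNorm_mono fun x => ?_).trans hfg
    by_cases hx : x ∈ K
    · simp [hχ1 x hx]
    · simp only [Pi.sub_apply, Pi.mul_apply, Function.comp_apply, hfK x hx, zero_sub, norm_neg,
        norm_mul]
      exact mul_le_of_le_one_left (norm_nonneg _) (by
        rw [Real.norm_eq_abs, abs_of_nonneg (hχ _).1]; exact (hχ _).2)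
  have hgχ : HasCompactSupport ((χ ∘ t) * g) := hgc.mul_left
  obtain ⟨φ, hφ, hφg, hφ0⟩ :=
    h.exists_testFun_eLpNorm_sub_le_of_continuous m (hχc.mul hg) hgχ hδ2
  refine ⟨φ, hφ, ?_, fun x hx => hφ0 x (by simp [hχ0 x hx])⟩
  have hgm' : MemLp ((χ ∘ t) * g) 2 m := (hχc.mul hg).memLp_of_hasCompactSupport hgχ
  rw [show f - φ ∘ t = (f - (χ ∘ t) * g) + ((χ ∘ t) * g - φ ∘ t) by abel]
  refine (eLpNorm_add_le (hf.sub hgm').1 (hgm'.sub (h.memLp_testFun_comp hφ)).1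
    (by simp)).trans ?_
  exact (add_le_add hfχ hφg).trans (ENNReal.add_halves δ).le

end IsCoord

end Coord

/-! ### Derivatives with respect to a scale -/

section ScaleDeriv

open Topology

/-- Cauchy–Schwarz against the indicator of `A`. -/
theorem abs_setIntegral_le_of_memLp {X : Type*} [MeasurableSpace X] {μ : Measure X} {φ : X → ℝ}
    (hφ : MemLp φ 2 μ) {A : Set X} (hA : MeasurableSet A) (hμA : μ A ≠ ⊤) :
    |∫ x in A, φ x ∂μ| ≤ (eLpNorm φ 2 μ).toReal * √(μ.real A) := by
  have h1 := L2.inner_indicatorConstLp_one hA hμA (hφ.toLp φ)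
  have h2 : ∫ x in A, (hφ.toLp φ) x ∂μ = ∫ x in A, φ x ∂μ :=
    integral_congr_ae (ae_restrict_of_ae hφ.coeFn_toLp)
  rw [← h2, ← h1, ← Real.norm_eq_abs]
  refine (norm_inner_le_norm _ _).trans ?_
  rw [norm_indicatorConstLp (by simp) (by simp), Lp.norm_toLp, mul_comm, Real.sqrt_eq_rpow]
  simp

variable {I : Set ℝ} [I.OrdConnected]

/-- Two densities whose integrals agree on all half-open subintervals of `(a, b]` have the same
integrals over all measurable subsets of `(a, b]`. -/
theorem setIntegral_eq_of_forall_Ioc {μ ν : Measure I} {f g : I → ℝ} {a b : I} (hab : a ≤ b)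
    (hf : IntegrableOn f (Ioc a b) μ) (hg : IntegrableOn g (Ioc a b) ν)
    (h : ∀ x y, a ≤ x → x ≤ y → y ≤ b → ∫ z in Ioc x y, f z ∂μ = ∫ z in Ioc x y, g z ∂ν)
    {B : Set I} (hB : MeasurableSet B) (hBab : B ⊆ Ioc a b) :
    ∫ z in B, f z ∂μ = ∫ z in B, g z ∂ν := by
  -- Dynkin's lemma for the half-open intervals. Intersecting with the fixed interval keeps all
  -- integrals finite and makes the complement step a subtraction from the total.
  have key : ∀ B : Set I, MeasurableSet B →
      ∫ z in Ioc a b ∩ B, f z ∂μ = ∫ z in Ioc a b ∩ B, g z ∂ν := by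
    intro B hB
    induction B, hB using MeasurableSpace.induction_on_inter
      ((BorelSpace.measurable_eq (α := I)).trans (borel_eq_generateFrom_Ioc I))
      (isPiSystem_Ioc id id) with
    | empty => simp
    | basic B hB =>
      obtain ⟨x, y, hxy, rfl⟩ := hB
      simp only [Ioc_inter_Ioc]
      rcases le_total (max a x) (min b y) with hle | hle
      · exact h _ _ (le_max_left _ _) hle (min_le_left _ _)
      · rw [Ioc_eq_empty (not_lt.2 hle)]; simp
    | compl B hB ih =>
      have h1 := integral_inter_add_sdiff hB hf
      have h2 := integral_inter_add_sdiff hB hg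
      rw [h a b le_rfl hab le_rfl] at h1
      rw [← sdiff_eq]
      linarith
    | iUnion B hd hB ih =>
      rw [inter_iUnion, integral_iUnion (fun i => measurableSet_Ioc.inter (hB i))
        (fun i j hij => (hd hij).mono inter_subset_right inter_subset_right)
        (hf.mono_set (iUnion_subset fun i => inter_subset_left)),
        integral_iUnion (fun i => measurableSet_Ioc.inter (hB i))
        (fun i j hij => (hd hij).mono inter_subset_right inter_subset_right)
        (hg.mono_set (iUnion_subset fun i => inter_subset_left))]
      exact tsum_congr ih
  have := key B hB
  rwa [inter_eq_right.2 hBab] at this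

namespace IsCoord

variable {s t : I → ℝ}

theorem integrableOn_Ioc (h : IsCoord s) {φ : I → ℝ} (hφ : MemLp φ 2 (scaleMeasure s)) (x y : I) :
    IntegrableOn φ (Ioc x y) (scaleMeasure s) := by
  have : IsFiniteMeasure ((scaleMeasure s).restrict (Ioc x y)) :=
    ⟨by simpa using h.scaleMeasure_Ioc_lt_top x y⟩
  exact (hφ.restrict (Ioc x y)).integrable (by norm_num)

theorem abs_setIntegral_Ioc_le (h : IsCoord s) {φ : I → ℝ} (hφ : MemLp φ 2 (scaleMeasure s))
    {x y : I} (hxy : x ≤ y) :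
    |∫ z in Ioc x y, φ z ∂(scaleMeasure s)| ≤
      (eLpNorm φ 2 (scaleMeasure s)).toReal * √(s y - s x) := by
  have := abs_setIntegral_le_of_memLp hφ measurableSet_Ioc (h.scaleMeasure_Ioc_lt_top x y).ne
  rwa [Measure.real, h.scaleMeasure_Ioc,
    ENNReal.toReal_ofReal (sub_nonneg.2 (h.strictMono.monotone hxy))] at this

/-- By Cauchy–Schwarz, `v` is Hölder continuous of order `1/2` with respect to `s`. -/
theorem continuous_of_scaleDeriv (h : IsCoord s) {φ v : I → ℝ} (hφ : MemLp φ 2 (scaleMeasure s))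
    (hv : ∀ x y : I, x ≤ y → v y - v x = ∫ z in Ioc x y, φ z ∂(scaleMeasure s)) :
    Continuous v := by
  have key : ∀ x y, |v y - v x| ≤ (eLpNorm φ 2 (scaleMeasure s)).toReal * √|s y - s x| := by
    intro x y
    rcases le_total x y with hxy | hxy
    · rw [hv x y hxy, abs_of_nonneg (sub_nonneg.2 (h.strictMono.monotone hxy))]
      exact h.abs_setIntegral_Ioc_le hφ hxy
    · rw [abs_sub_comm, hv y x hxy, abs_sub_comm (s y),
        abs_of_nonneg (sub_nonneg.2 (h.strictMono.monotone hxy))]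
      exact h.abs_setIntegral_Ioc_le hφ hxy
  refine continuous_iff_continuousAt.2 fun x => ?_
  rw [ContinuousAt, tendsto_iff_norm_sub_tendsto_zero]
  have hc : Continuous fun y => (eLpNorm φ 2 (scaleMeasure s)).toReal * √|s y - s x| :=
    continuous_const.mul ((h.continuous.sub continuous_const).abs.sqrt)
  refine squeeze_zero (fun y => norm_nonneg _) (fun y => key x y) ?_
  simpa using hc.tendsto x

theorem ae_eq_of_forall_Ioc (h : IsCoord s) {φ ψ : I → ℝ} (hφ : MemLp φ 2 (scaleMeasure s))
    (hψ : MemLp ψ 2 (scaleMeasure s))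
    (heq : ∀ x y : I, x ≤ y → ∫ z in Ioc x y, φ z ∂(scaleMeasure s) =
      ∫ z in Ioc x y, ψ z ∂(scaleMeasure s)) : φ =ᵐ[scaleMeasure s] ψ := by
  have hloc : ∀ a b : I, φ =ᵐ[(scaleMeasure s).restrict (Ioc a b)] ψ := by
    intro a b
    rcases le_or_gt b a with hab | hab
    · rw [Ioc_eq_empty (not_lt.2 hab), Measure.restrict_empty]
      exact ae_zero.symm ▸ trivial
    · refine Integrable.ae_eq_of_forall_setIntegral_eq _ _ (h.integrableOn_Ioc hφ a b)
        (h.integrableOn_Ioc hψ a b) fun B hB _ => ?_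
      rw [Measure.restrict_restrict hB]
      exact setIntegral_eq_of_forall_Ioc hab.le (h.integrableOn_Ioc hφ a b)
        (h.integrableOn_Ioc hψ a b) (fun x y _ hxy _ => heq x y hxy)
        (hB.inter measurableSet_Ioc) inter_subset_right
  refine measure_null_of_locally_null _ fun x _ => ?_
  obtain ⟨a, b, hx⟩ := h.exists_Ioo_mem x
  refine ⟨{z | φ z = ψ z}ᶜ ∩ Ioc a b, inter_mem_nhdsWithin _ ?_, ?_⟩
  · exact mem_of_superset (Ioo_mem_nhds hx.1 hx.2) Ioo_subset_Ioc_self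
  · have := hloc a b
    rwa [EventuallyEq, ae_iff, Measure.restrict_apply' measurableSet_Ioc] at this

end IsCoord

variable {s t : I → ℝ} {m : Measure I} {u v : Lp ℝ 2 m} {φ ψ : I → ℝ}

namespace HasScaleDeriv

theorem congr (h : HasScaleDeriv s u φ) (hψ : φ =ᵐ[scaleMeasure s] ψ) : HasScaleDeriv s u ψ := by
  obtain ⟨h1, v, h2, h3⟩ := h
  refine ⟨(memLp_congr_ae hψ).1 h1, v, h2, fun x y hxy => ?_⟩
  rw [h3 x y hxy]
  exact integral_congr_ae (ae_restrict_of_ae hψ)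

theorem toLp (h : HasScaleDeriv s u φ) : HasScaleDeriv s u (h.1.toLp φ) :=
  h.congr h.1.coeFn_toLp.symm

theorem add (hs : IsCoord s) (hu : HasScaleDeriv s u φ) (hv : HasScaleDeriv s v ψ) :
    HasScaleDeriv s (u + v) (φ + ψ) := by
  obtain ⟨h1, u', h2, h3⟩ := hu
  obtain ⟨k1, v', k2, k3⟩ := hv
  refine ⟨h1.add k1, u' + v', (Lp.coeFn_add u v).trans (h2.add k2), fun x y hxy => ?_⟩
  simp only [Pi.add_apply]
  rw [integral_add (hs.integrableOn_Ioc h1 x y) (hs.integrableOn_Ioc k1 x y), ← h3 x y hxy,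
    ← k3 x y hxy]
  ring

theorem smul (c : ℝ) (hu : HasScaleDeriv s u φ) : HasScaleDeriv s (c • u) (c • φ) := by
  obtain ⟨h1, u', h2, h3⟩ := hu
  refine ⟨h1.const_smul c, c • u', (Lp.coeFn_smul c u).trans (h2.const_smul c), fun x y hxy => ?_⟩
  simp only [Pi.smul_apply]
  rw [integral_smul, ← h3 x y hxy, smul_sub]

theorem zero : HasScaleDeriv s (0 : Lp ℝ 2 m) 0 :=
  ⟨MemLp.zero, 0, Lp.coeFn_zero _ _ _, fun x y _ => by simp⟩

theorem sub (hs : IsCoord s) (hu : HasScaleDeriv s u φ) (hv : HasScaleDeriv s v ψ) :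
    HasScaleDeriv s (u - v) (φ - ψ) := by
  have := hu.add hs (hv.smul (-1))
  simpa [sub_eq_add_neg] using this

/-- Two versions of `u` are continuous and agree `m`-a.e.; full support of `m` makes them equal
everywhere, so their densities have equal integrals over intervals. -/
theorem ae_eq [m.IsOpenPosMeasure] (hs : IsCoord s) (hφ : HasScaleDeriv s u φ)
    (hψ : HasScaleDeriv s u ψ) : φ =ᵐ[scaleMeasure s] ψ := by
  obtain ⟨h1, u', h2, h3⟩ := hφ
  obtain ⟨k1, v', k2, k3⟩ := hψ
  have : u' = v' := ((hs.continuous_of_scaleDeriv h1 h3).ae_eq_iff_eq m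
    (hs.continuous_of_scaleDeriv k1 k3)).1 (h2.symm.trans k2)
  subst this
  exact hs.ae_eq_of_forall_Ioc h1 k1 fun x y hxy => (h3 x y hxy).symm.trans (k3 x y hxy)

theorem scaleDeriv_ae_eq [m.IsOpenPosMeasure] (hs : IsCoord s) (hφ : HasScaleDeriv s u φ) :
    scaleDeriv s u =ᵐ[scaleMeasure s] φ := by
  have h : ∃ φ, HasScaleDeriv s u φ := ⟨φ, hφ⟩
  rw [scaleDeriv, dif_pos h]
  exact h.choose_spec.ae_eq hs hφ

theorem form_eq [m.IsOpenPosMeasure] (hs : IsCoord s) (hφ : HasScaleDeriv s u φ)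
    (hψ : HasScaleDeriv s v ψ) :
    (maxScaleForm s m).form u v = 1 / 2 * ∫ x, φ x * ψ x ∂(scaleMeasure s) := by
  have := integral_congr_ae ((hφ.scaleDeriv_ae_eq hs).mul (hψ.scaleDeriv_ae_eq hs))
  exact congrArg (1 / 2 * ·) this

theorem form_toLp_self [m.IsOpenPosMeasure] (hs : IsCoord s) {Φ : Lp ℝ 2 (scaleMeasure s)}
    (hφ : HasScaleDeriv s u Φ) : (maxScaleForm s m).form u u = 1 / 2 * ‖Φ‖ ^ 2 := by
  rw [hφ.form_eq hs hφ, Lp_norm_sq_eq_integral]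
  simp_rw [pow_two]

/-- The operator `u ↦ du/ds` is closed. Increments of the versions converge for every pair of
points, and along a subsequence their values converge at some point `x₀`; hence they converge
everywhere, and the limit is the required version. -/
theorem of_tendsto [m.IsOpenPosMeasure] (e : I) (hs : IsCoord s) {u : ℕ → Lp ℝ 2 m}
    {Φ : ℕ → Lp ℝ 2 (scaleMeasure s)} (h : ∀ n, HasScaleDeriv s (u n) (Φ n))
    {u₀ : Lp ℝ 2 m} {Φ₀ : Lp ℝ 2 (scaleMeasure s)} (hu : Tendsto u atTop (𝓝 u₀))
    (hΦ : Tendsto Φ atTop (𝓝 Φ₀)) : HasScaleDeriv s u₀ Φ₀ := by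
  choose hmem v hv hvΦ using h
  have hint : ∀ x y : I, x ≤ y → Tendsto (fun n => v n y - v n x) atTop
      (𝓝 (∫ z in Ioc x y, Φ₀ z ∂(scaleMeasure s))) := by
    intro x y hxy
    rw [tendsto_iff_norm_sub_tendsto_zero] at hΦ ⊢
    refine squeeze_zero (fun n => norm_nonneg _) (fun n => ?_)
      (by simpa using hΦ.mul_const √(s y - s x))
    have h1 : v n y - v n x - ∫ z in Ioc x y, Φ₀ z ∂(scaleMeasure s) =
        ∫ z in Ioc x y, (Φ n - Φ₀ : Lp ℝ 2 (scaleMeasure s)) z ∂(scaleMeasure s) := by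
      rw [hvΦ n x y hxy, ← integral_sub (hs.integrableOn_Ioc (Lp.memLp _) x y)
        (hs.integrableOn_Ioc (Lp.memLp _) x y)]
      exact integral_congr_ae (ae_restrict_of_ae (Lp.coeFn_sub _ _).symm)
    rw [h1, Lp.norm_def]
    exact hs.abs_setIntegral_Ioc_le (Lp.memLp _) hxy
  obtain ⟨ns, hns, hae⟩ := (tendstoInMeasure_of_tendsto_Lp hu).exists_seq_tendsto_ae
  have hae' : ∀ᵐ x ∂m, Tendsto (fun i => v (ns i) x) atTop (𝓝 (u₀ x)) := by
    filter_upwards [hae, ae_all_iff.2 hv] with x h1 h2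
    exact h1.congr fun i => h2 (ns i)
  have hne : (ae m).NeBot := by
    rw [ae_neBot]
    intro h0
    exact isOpen_univ.measure_ne_zero m ⟨e, trivial⟩ (by simp [h0])
  obtain ⟨x₀, hx₀⟩ := hae'.exists
  have hlim : ∀ x, ∃ l, Tendsto (fun i => v (ns i) x) atTop (𝓝 l) := by
    intro x
    rcases le_total x₀ x with hx | hx
    · refine ⟨_, (((hint x₀ x hx).comp hns.tendsto_atTop).add hx₀).congr fun i => ?_⟩
      simp
    · refine ⟨_, (hx₀.sub ((hint x x₀ hx).comp hns.tendsto_atTop)).congr fun i => ?_⟩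
      simp
  choose w hw using hlim
  refine ⟨Lp.memLp _, w, ?_, fun x y hxy => ?_⟩
  · filter_upwards [hae'] with x hx
    exact tendsto_nhds_unique hx (hw x)
  · exact tendsto_nhds_unique ((hw y).sub (hw x)) ((hint x y hxy).comp hns.tendsto_atTop)

end HasScaleDeriv

theorem deriv_mem_testFun {U : Set ℝ} {φ : ℝ → ℝ} (hφ : φ ∈ testFun U) :
    deriv φ ∈ testFun U :=
  ⟨(contDiff_infty_iff_deriv.1 hφ.1).2, hφ.2.1.deriv, tsupport_deriv_subset.trans hφ.2.2⟩

/-- The fundamental theorem of calculus along a coordinate. -/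
theorem IsCoord.setIntegral_deriv_comp (ht : IsCoord t) {φ : ℝ → ℝ} (hφ : ContDiff ℝ ∞ φ)
    {x y : I} (hxy : x ≤ y) :
    φ (t y) - φ (t x) = ∫ z in Ioc x y, deriv φ (t z) ∂(scaleMeasure t) := by
  have h := contDiff_infty_iff_deriv.1 hφ
  rw [ht.setIntegral_comp, ← intervalIntegral.integral_of_le (ht.strictMono.monotone hxy),
    intervalIntegral.integral_deriv_eq_sub (fun x _ => h.1 x)
    (h.2.continuous.intervalIntegrable _ _)]

theorem IsCoord.isFiniteMeasureOnCompacts (ht : IsCoord t) :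
    IsFiniteMeasureOnCompacts (scaleMeasure t) := by
  have := ht.isLocallyFiniteMeasure
  infer_instance

theorem IsCoord.hasScaleDeriv_testFun (ht : IsCoord t) {φ : ℝ → ℝ} (hφ : φ ∈ testFun (range t))
    (hu : u =ᵐ[m] φ ∘ t) : HasScaleDeriv t u (deriv φ ∘ t) := by
  have := ht.isFiniteMeasureOnCompacts
  exact ⟨ht.memLp_testFun_comp (deriv_mem_testFun hφ), φ ∘ t, hu,
    fun x y hxy => ht.setIntegral_deriv_comp hφ.1 hxy⟩

theorem IsCoord.dense_of_testFun [IsFiniteMeasureOnCompacts m] (ht : IsCoord t)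
    {D : Set (Lp ℝ 2 m)} (hD : ∀ f ∈ testFunComp t, ∀ w : Lp ℝ 2 m, w =ᵐ[m] f → w ∈ D) :
    Dense D := by
  intro u
  rw [Metric.mem_closure_iff]
  intro ε hε
  obtain ⟨φ, hφ, hle⟩ := ht.exists_testFun_eLpNorm_sub_le m (Lp.memLp u)
    (δ := ENNReal.ofReal (ε / 2)) (by simpa using hε)
  have hm : MemLp (φ ∘ t) 2 m := ht.memLp_testFun_comp hφ
  refine ⟨hm.toLp _, hD _ ⟨φ, hφ, rfl⟩ _ hm.coeFn_toLp, ?_⟩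
  rw [Lp.dist_def]
  have h1 : eLpNorm (u - hm.toLp _ : I → ℝ) 2 m = eLpNorm (u - φ ∘ t : I → ℝ) 2 m :=
    eLpNorm_congr_ae (EventuallyEq.rfl.sub hm.coeFn_toLp)
  rw [h1]
  have h2 := ENNReal.toReal_mono ENNReal.ofReal_ne_top hle
  rw [ENNReal.toReal_ofReal (by positivity)] at h2
  linarith

/-! ### The form of a coordinate as a regular Dirichlet form -/

variable [m.IsOpenPosMeasure] [IsFiniteMeasureOnCompacts m]

theorem IsCoord.isClosedForm_maxScaleForm (e : I) (hs : IsCoord s) :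
    (maxScaleForm s m).IsClosedForm where
  zero_mem := ⟨0, HasScaleDeriv.zero⟩
  add_mem := by
    rintro u ⟨φ, hφ⟩ v ⟨ψ, hψ⟩
    exact ⟨_, hφ.add hs hψ⟩
  smul_mem := by
    rintro c u ⟨φ, hφ⟩
    exact ⟨_, hφ.smul c⟩
  dense := hs.dense_of_testFun (by
    rintro _ ⟨φ, hφ, rfl⟩ w hw
    exact ⟨_, hs.hasScaleDeriv_testFun hφ hw⟩)
  symm := by
    intro u _ v _
    simp only [maxScaleForm, mul_comm]
  add_left := by
    rintro u ⟨φ, hφ⟩ v ⟨ψ, hψ⟩ w ⟨η, hη⟩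
    have := integral_add (hφ.1.integrable_mul hη.1) (hψ.1.integrable_mul hη.1)
    simp only [Pi.mul_apply] at this
    rw [(hφ.add hs hψ).form_eq hs hη, hφ.form_eq hs hη, hψ.form_eq hs hη, ← mul_add, ← this]
    simp only [Pi.add_apply, add_mul]
  smul_left := by
    rintro c u ⟨φ, hφ⟩ v ⟨ψ, hψ⟩
    rw [(hφ.smul c).form_eq hs hψ, hφ.form_eq hs hψ]
    simp only [Pi.smul_apply, smul_eq_mul, mul_assoc, integral_const_mul]
    ring
  nonneg := by
    rintro u ⟨φ, hφ⟩
    rw [hφ.toLp.form_toLp_self hs]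
    positivity
  complete := by
    intro u hu hC
    choose φ hφ using hu
    set Φ := fun n => (hφ n).1.toLp (φ n)
    have hΦ : ∀ n, HasScaleDeriv s (u n) (Φ n) := fun n => (hφ n).toLp
    -- The squared energy norm splits into the squared norms of the function and of its derivative,
    -- so a Cauchy sequence is Cauchy in `L²(m)` and in `L²(ds)` separately.
    have hen : ∀ (a b : Lp ℝ 2 m) (A B : Lp ℝ 2 (scaleMeasure s)), HasScaleDeriv s a A →
        HasScaleDeriv s b B →
        (maxScaleForm s m).energyOne (a - b) = 1 / 2 * ‖A - B‖ ^ 2 + ‖a - b‖ ^ 2 := by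
      intro a b A B ha hb
      rw [L2Form.energyOne, ((ha.sub hs hb).congr (Lp.coeFn_sub A B).symm).form_toLp_self hs]
    have hcu : CauchySeq u := Metric.cauchySeq_iff.2 fun ε hε => by
      obtain ⟨N, hN⟩ := hC (ε ^ 2) (by positivity)
      refine ⟨N, fun p hp q hq => ?_⟩
      have := hN p hp q hq
      rw [hen _ _ _ _ (hΦ p) (hΦ q)] at this
      rw [dist_eq_norm]
      exact lt_of_pow_lt_pow_left₀ 2 hε.le (by nlinarith [sq_nonneg ‖Φ p - Φ q‖])
    have hcΦ : CauchySeq Φ := Metric.cauchySeq_iff.2 fun ε hε => by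
      obtain ⟨N, hN⟩ := hC (1 / 2 * ε ^ 2) (by positivity)
      refine ⟨N, fun p hp q hq => ?_⟩
      have := hN p hp q hq
      rw [hen _ _ _ _ (hΦ p) (hΦ q)] at this
      rw [dist_eq_norm]
      exact lt_of_pow_lt_pow_left₀ 2 hε.le (by nlinarith [sq_nonneg ‖u p - u q‖])
    obtain ⟨u₀, hu₀⟩ := cauchySeq_tendsto_of_complete hcu
    obtain ⟨Φ₀, hΦ₀⟩ := cauchySeq_tendsto_of_complete hcΦ
    have h0 := HasScaleDeriv.of_tendsto e hs hΦ hu₀ hΦ₀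
    refine ⟨u₀, ⟨_, h0⟩, ?_⟩
    simp_rw [hen _ _ _ _ (hΦ _) h0]
    rw [tendsto_iff_norm_sub_tendsto_zero] at hu₀ hΦ₀
    have := ((hΦ₀.pow 2).const_mul (1 / 2)).add (hu₀.pow 2)
    simpa only [ne_eq, OfNat.ofNat_ne_zero, not_false_eq_true, zero_pow, mul_zero, add_zero] using
      this

theorem IsCoord.isClosedForm_scaleForm (e : I) (hs : IsCoord s) :
    (scaleForm s m).IsClosedForm := by
  have h := hs.isClosedForm_maxScaleForm (m := m) e
  exact h.isClosedForm_closureForm (isLinearSpace_testFunComp s) (hs.dense_of_testFun (by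
    rintro _ ⟨φ, hφ, rfl⟩ w hw
    exact h.self_mem_closureIn ⟨_, hs.hasScaleDeriv_testFun hφ hw⟩ ⟨φ, hφ, rfl⟩ hw))

theorem IsCoord.mem_maxScaleForm (hs : IsCoord s) {f : I → ℝ} (hf : f ∈ testFunComp s) :
    (maxScaleForm s m).Mem f := by
  obtain ⟨φ, hφ, rfl⟩ := hf
  have hm : MemLp (φ ∘ s) 2 m := hs.memLp_testFun_comp hφ
  exact ⟨hm.toLp _, ⟨_, hs.hasScaleDeriv_testFun hφ hm.coeFn_toLp⟩, hm.coeFn_toLp⟩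

theorem IsCoord.mem_scaleForm (e : I) (hs : IsCoord s) {f : I → ℝ} (hf : f ∈ testFunComp s) :
    (scaleForm s m).Mem f := by
  obtain ⟨w, hw, hwf⟩ := hs.mem_maxScaleForm (m := m) hf
  exact ⟨w, (hs.isClosedForm_maxScaleForm e).self_mem_closureIn hw hf hwf, hwf⟩

theorem IsCoord.exists_testFunComp_abs_sub_lt (hs : IsCoord s) (h : I → ℝ) (hc : Continuous h)
    (hcs : HasCompactSupport h) (ε : ℝ) (hε : 0 < ε) :
    ∃ f ∈ testFunComp s, ∀ x, |h x - f x| < ε := by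
  obtain ⟨φ, hφ, h1, -⟩ := hs.exists_testFun_abs_sub_lt hc hcs hε
  exact ⟨_, ⟨φ, hφ, rfl⟩, h1⟩

/-- Dense test functions of a coordinate form a special standard core. -/
theorem isSpecialStandardCore_testFunComp {𝓔 : L2Form m} (hs : IsCoord s)
    (hmem : ∀ f ∈ testFunComp s, 𝓔.Mem f) (hd : 𝓔.closureIn (testFunComp s) = 𝓔.domain) :
    𝓔.IsSpecialStandardCore (testFunComp s) where
  continuous := by
    rintro _ ⟨φ, hφ, rfl⟩
    exact hφ.1.continuous.comp hs.continuous
  compactSupport := by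
    rintro _ ⟨φ, hφ, rfl⟩
    exact hs.hasCompactSupport_comp hφ
  mem := hmem
  dense_domain := hd
  dense_uniform := hs.exists_testFunComp_abs_sub_lt
  zero_mem := (isLinearSpace_testFunComp s).zero_mem
  add_mem := (isLinearSpace_testFunComp s).add_mem
  smul_mem := (isLinearSpace_testFunComp s).smul_mem
  contraction ε hε := by
    obtain ⟨η, hη⟩ := exists_isApproxContraction hε
    refine ⟨η, hη.eq_self, hη.mem_Icc, hη.incr, ?_⟩
    rintro _ ⟨φ, hφ, rfl⟩
    exact ⟨η ∘ φ, comp_mem_testFun hφ hη.contDiff hη.map_zero, rfl⟩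
  mul_mem f hf g hg := mul_mem_testFunComp hf hg
  cutoff K G hK hG _ hKG := by
    obtain ⟨φ, hφ, h01, h1, h0⟩ := hs.exists_cutoff hK hG hKG
    exact ⟨_, ⟨φ, hφ, rfl⟩, fun x => (h01 _).1, h1, h0⟩

theorem IsCoord.isRegularDirichletForm_scaleForm (e : I) (hs : IsCoord s) :
    (scaleForm s m).IsRegularDirichletForm where
  toIsDirichletForm := by
    have h := hs.isClosedForm_maxScaleForm (m := m) e
    refine h.isDirichletForm_closureForm (isLinearSpace_testFunComp s)
      (hs.isClosedForm_scaleForm e).dense (fun f hf => hs.mem_maxScaleForm hf) ?_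
    rintro ε η hη _ ⟨φ, hφ, rfl⟩
    have hηφ := comp_mem_testFun hφ hη.contDiff hη.map_zero
    refine ⟨⟨η ∘ φ, hηφ, rfl⟩, fun u _ w _ hu hw => ?_⟩
    have h1 := hs.hasScaleDeriv_testFun hφ hu
    have h2 := hs.hasScaleDeriv_testFun hηφ hw
    rw [h1.form_eq hs h1, h2.form_eq hs h2]
    refine mul_le_mul_of_nonneg_left (integral_mono (h2.1.integrable_mul h2.1)
      (h1.1.integrable_mul h1.1) fun x => ?_) (by norm_num)
    -- The chain rule and `|η'| ≤ 1` bound the energy density pointwise.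
    have hd : deriv (η ∘ φ) (s x) = deriv η (φ (s x)) * deriv φ (s x) :=
      deriv_comp _ ((contDiff_infty_iff_deriv.1 hη.contDiff).1 _)
        ((contDiff_infty_iff_deriv.1 hφ.1).1 _)
    simp only [Function.comp_apply] at hd ⊢
    rw [hd, ← abs_mul_abs_self, ← abs_mul_abs_self (deriv φ (s x)), abs_mul]
    have := hη.abs_deriv_le (φ (s x))
    gcongr <;> exact mul_le_of_le_one_left (abs_nonneg _) this
  exists_core := by
    have h := hs.isClosedForm_maxScaleForm (m := m) e
    have h' := hs.isClosedForm_scaleForm (m := m) e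
    refine ⟨testFunComp s, (isSpecialStandardCore_testFunComp hs
      (fun f hf => hs.mem_scaleForm e hf) ?_).toIsCore⟩
    rw [← h'.closureIn_eq_of_extends h (L2Form.extends_closureForm _ _)
      fun f hf => hs.mem_scaleForm e hf]
    rfl

end ScaleDeriv

/-! ### Density of the test functions of a coordinate -/

section Density

open Topology

/-- Multiplication by `k` preserves norms from `L²(k² μ)` to `L²(μ)`. Approximation by `F(t) k` in
`L²(ds)` thus becomes approximation by test functions for the locally finite measure `k² ds`. -/
theorem eLpNorm_mul_eq_withDensity_sq {X : Type*} [MeasurableSpace X] {μ : Measure X}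
    {k : X → NNReal} (hk : Measurable k) (f : X → ℝ) :
    eLpNorm (fun x => f x * k x) 2 μ =
      eLpNorm f 2 (μ.withDensity fun x => ((k x ^ 2 : NNReal) : ℝ≥0∞)) := by
  rw [eLpNorm_eq_lintegral_rpow_enorm_toReal (by simp) (by simp),
    eLpNorm_eq_lintegral_rpow_enorm_toReal (by simp) (by simp),
    lintegral_withDensity_eq_lintegral_mul_non_measurable _ (by fun_prop)
      (Eventually.of_forall fun x => ENNReal.coe_lt_top)]
  congr 1
  refine lintegral_congr fun x => ?_
  simp [enorm_mul, mul_pow, mul_comm]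

variable {I : Set ℝ} [I.OrdConnected] {s t : I → ℝ} {m : Measure I}

/-- The coordinate `t` has density `k ∈ L²_loc(ds)` with respect to the coordinate `s`, and `k`
does not vanish. -/
structure HasSqDensity (s t : I → ℝ) (k : I → NNReal) : Prop where
  coord_left : IsCoord s
  coord_right : IsCoord t
  measurable : Measurable k
  ne_zero : ∀ᵐ x ∂(scaleMeasure s), k x ≠ 0
  eq_withDensity : scaleMeasure t = (scaleMeasure s).withDensity fun x => (k x : ℝ≥0∞)
  sq_lt_top : ∀ a b, ∫⁻ x in Ioc a b, ((k x ^ 2 : NNReal) : ℝ≥0∞) ∂(scaleMeasure s) < ⊤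

theorem IsCoord.hasSqDensity_self (h : IsCoord s) : HasSqDensity s s 1 where
  coord_left := h
  coord_right := h
  measurable := measurable_const
  ne_zero := Eventually.of_forall fun _ => one_ne_zero
  eq_withDensity := by simp
  sq_lt_top a b := by simpa using h.scaleMeasure_Ioc_lt_top a b

namespace HasSqDensity

variable {k : I → NNReal}

theorem isFiniteMeasureOnCompacts (h : HasSqDensity s t k) : IsFiniteMeasureOnCompacts
    ((scaleMeasure s).withDensity fun x => ((k x ^ 2 : NNReal) : ℝ≥0∞)) := by
  have : IsLocallyFiniteMeasure
      ((scaleMeasure s).withDensity fun x => ((k x ^ 2 : NNReal) : ℝ≥0∞)) := ⟨fun x => by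
    obtain ⟨a, b, hab⟩ := h.coord_left.exists_Ioo_mem x
    refine ⟨Ioc a b, mem_of_superset (Ioo_mem_nhds hab.1 hab.2) Ioo_subset_Ioc_self, ?_⟩
    rw [withDensity_apply _ measurableSet_Ioc]
    exact h.sq_lt_top a b⟩
  infer_instance

theorem setIntegral_eq (h : HasSqDensity s t k) (F : I → ℝ) (x y : I) :
    ∫ z in Ioc x y, F z ∂(scaleMeasure t) = ∫ z in Ioc x y, F z * k z ∂(scaleMeasure s) := by
  rw [h.eq_withDensity, setIntegral_withDensity_eq_setIntegral_smul h.measurable _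
    measurableSet_Ioc]
  simp only [NNReal.smul_def, smul_eq_mul, mul_comm]

theorem memLp_testFun_mul (h : HasSqDensity s t k) {F : ℝ → ℝ} (hF : F ∈ testFun (range t)) :
    MemLp (fun x => F (t x) * k x) 2 (scaleMeasure s) := by
  have := h.isFiniteMeasureOnCompacts
  have h1 : MemLp (F ∘ t) 2 ((scaleMeasure s).withDensity fun x => ((k x ^ 2 : NNReal) : ℝ≥0∞)) :=
    h.coord_right.memLp_testFun_comp hF
  have hc : Continuous fun x => F (t x) := hF.1.continuous.comp h.coord_right.continuous
  refine ⟨(hc.measurable.mul h.measurable.coe_nnreal_real).aestronglyMeasurable, ?_⟩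
  rw [eLpNorm_mul_eq_withDensity_sq h.measurable]
  exact h1.2

theorem hasScaleDeriv_testFun (h : HasSqDensity s t k) {φ : ℝ → ℝ} (hφ : φ ∈ testFun (range t))
    {u : Lp ℝ 2 m} (hu : u =ᵐ[m] φ ∘ t) :
    HasScaleDeriv s u (fun x => deriv φ (t x) * k x) := by
  refine ⟨h.memLp_testFun_mul (deriv_mem_testFun hφ), φ ∘ t, hu, fun x y hxy => ?_⟩
  rw [← h.setIntegral_eq (fun z => deriv φ (t z))]
  exact h.coord_right.setIntegral_deriv_comp hφ.1 hxy

theorem exists_testFun_norm_sub_le (h : HasSqDensity s t k) (Ψ : Lp ℝ 2 (scaleMeasure s))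
    {K U : Set I} (hK : IsCompact K) (hU : IsOpen U) (hKU : K ⊆ U)
    (hΨ : ∀ᵐ x ∂(scaleMeasure s), x ∉ K → Ψ x = 0) {δ : ℝ} (hδ : 0 < δ) :
    ∃ F, ∃ hF : F ∈ testFun (range t), ‖Ψ - (h.memLp_testFun_mul hF).toLp _‖ ≤ δ ∧
      ∀ x ∉ U, F (t x) = 0 := by
  have := h.isFiniteMeasureOnCompacts
  set ν := (scaleMeasure s).withDensity fun x => ((k x ^ 2 : NNReal) : ℝ≥0∞)
  -- The function to be approximated in `L²(k² ds)` is `Ψ / k`, which is legitimate as `k ≠ 0` a.e.;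
  -- the indicator makes it vanish off `K` everywhere and not only a.e.
  set f : I → ℝ := K.indicator fun x => Ψ x / k x
  have hfk : (fun x => f x * k x) =ᵐ[scaleMeasure s] Ψ := by
    filter_upwards [h.ne_zero, hΨ] with x h1 h2
    by_cases hx : x ∈ K
    · have : (k x : ℝ) ≠ 0 := by exact_mod_cast h1
      simp [f, hx, div_mul_cancel₀ _ this]
    · simp [f, hx, h2 hx]
  have hfm : AEStronglyMeasurable f ν :=
    (((Lp.aestronglyMeasurable Ψ).aemeasurable.div
      h.measurable.coe_nnreal_real.aemeasurable).indicator
      hK.isClosed.measurableSet).aestronglyMeasurable.mono_ac (withDensity_absolutelyContinuous _ _)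
  have hf : MemLp f 2 ν := ⟨hfm, by
    rw [← eLpNorm_mul_eq_withDensity_sq h.measurable, eLpNorm_congr_ae hfk]
    exact (Lp.memLp Ψ).2⟩
  obtain ⟨F, hF, hle, hF0⟩ := h.coord_right.exists_testFun_eLpNorm_sub_le_of_subset ν hf hK hU hKU
    (fun x hx => indicator_of_notMem hx _) (δ := ENNReal.ofReal δ) (by simpa using hδ)
  refine ⟨F, hF, ?_, hF0⟩
  rw [Lp.norm_def]
  refine ENNReal.toReal_le_of_le_ofReal hδ.le ?_
  rw [← eLpNorm_mul_eq_withDensity_sq h.measurable] at hle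
  refine le_trans (eLpNorm_congr_ae ?_).le hle
  filter_upwards [Lp.coeFn_sub Ψ ((h.memLp_testFun_mul hF).toLp _), hfk,
    (h.memLp_testFun_mul hF).coeFn_toLp] with x h1 h2 h3
  rw [h1, Pi.sub_apply, h3, ← h2, Pi.sub_apply, Function.comp_apply]
  ring

variable [m.IsOpenPosMeasure] [IsFiniteMeasureOnCompacts m]

/-- A Poincaré inequality: `w` vanishes at `a`, so Cauchy–Schwarz bounds it uniformly on `[a, b]` by
its derivative, and `m` is finite there. Closeness of derivatives therefore suffices for closeness
in the energy norm. -/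
theorem _root_.IsCoord.norm_le_of_hasScaleDeriv (hs : IsCoord s) {z : Lp ℝ 2 m} {w : I → ℝ}
    {D : Lp ℝ 2 (scaleMeasure s)} {a b : I} (hab : a ≤ b) (hzw : z =ᵐ[m] w)
    (hw : ∀ x y : I, x ≤ y → w y - w x = ∫ ξ in Ioc x y, D ξ ∂(scaleMeasure s))
    (hw0 : ∀ x, x ∉ Ioc a b → w x = 0) :
    ‖z‖ ^ 2 ≤ (s b - s a) * m.real (Icc a b) * ‖D‖ ^ 2 := by
  have hbd : ∀ x ∈ Icc a b, |w x| ≤ ‖D‖ * √(s b - s a) := by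
    intro x hx
    have h1 := hw a x hx.1
    rw [hw0 a (by simp), sub_zero] at h1
    rw [h1, Lp.norm_def]
    refine (hs.abs_setIntegral_Ioc_le (Lp.memLp D) hx.1).trans ?_
    gcongr
    exact hs.strictMono.monotone hx.2
  have hsub : 0 ≤ s b - s a := sub_nonneg.2 (hs.strictMono.monotone hab)
  have h1 : ‖z‖ ^ 2 = ∫ x in Icc a b, w x ^ 2 ∂m := by
    rw [Lp_norm_sq_eq_integral, setIntegral_eq_integral_of_forall_compl_eq_zero]
    · refine integral_congr_ae ?_
      filter_upwards [hzw] with x hx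
      rw [hx]
    · intro x hx
      rw [hw0 x fun h' => hx (Ioc_subset_Icc_self h')]
      simp
  have h2 := norm_setIntegral_le_of_norm_le_const (μ := m) (f := fun x => w x ^ 2)
    (C := (‖D‖ * √(s b - s a)) ^ 2) (isCompact_Icc_subtype a b).measure_lt_top (fun x hx => by
      rw [Real.norm_eq_abs, abs_pow]
      exact pow_le_pow_left₀ (abs_nonneg _) (hbd x hx) 2)
  rw [h1]
  refine (le_abs_self _).trans (h2.trans (le_of_eq ?_))
  rw [mul_pow, Real.sq_sqrt hsub]
  ring

theorem _root_.integral_eq_zero_of_notMem_Ioo {F : ℝ → ℝ} (hF : Continuous F) {α β : ℝ}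
    (hF0 : ∀ x ∉ Ioo α β, F x = 0) (hi : ∫ x in α..β, F x = 0) {y : ℝ} (hy : y ∉ Ioo α β) :
    ∫ x in α..y, F x = 0 := by
  rcases le_or_gt y α with h1 | h1
  · rw [intervalIntegral.integral_symm, intervalIntegral.integral_of_le h1,
      setIntegral_eq_zero_of_forall_eq_zero, neg_zero]
    exact fun x hx => hF0 x fun h' => not_lt.2 hx.2 h'.1
  · have h2 : β ≤ y := not_lt.1 fun h' => hy ⟨h1, h'⟩
    rw [← intervalIntegral.integral_add_adjacent_intervals
      (hF.intervalIntegrable α β) (hF.intervalIntegrable β y), hi, zero_add,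
      intervalIntegral.integral_of_le h2, setIntegral_eq_zero_of_forall_eq_zero]
    exact fun x hx => hF0 x fun h' => lt_asymm hx.1 h'.2

theorem _root_.mem_testFun_integral {F : ℝ → ℝ} {J : Set ℝ} (hF : ContDiff ℝ ∞ F) {α β : ℝ}
    (hJ : Icc α β ⊆ J) (hF0 : ∀ x ∉ Ioo α β, F x = 0) (hi : ∫ x in α..β, F x = 0) :
    (fun y => ∫ x in α..y, F x) ∈ testFun J := by
  have hsupp : Function.support (fun y => ∫ x in α..y, F x) ⊆ Icc α β := fun y hy =>
    Ioo_subset_Icc_self (by_contra fun hyn =>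
      hy (integral_eq_zero_of_notMem_Ioo hF.continuous hF0 hi hyn))
  exact ⟨contDiff_integral hF α, HasCompactSupport.of_support_subset_isCompact isCompact_Icc hsupp,
    (closure_minimal hsupp isClosed_Icc).trans hJ⟩

/-- If `v` has compact support and `dv = ψ ds` with `ψ ∈ L²(ds)`, then `v` is approximated by
the test functions of the coordinate `t`. -/
theorem mem_closureIn_testFunComp (h : HasSqDensity s t k) (e : I) {u : Lp ℝ 2 m} {v ψ : I → ℝ}
    (hvc : HasCompactSupport v) (hψ : MemLp ψ 2 (scaleMeasure s))
    (hv : ∀ x y : I, x ≤ y → v y - v x = ∫ z in Ioc x y, ψ z ∂(scaleMeasure s))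
    (hu : u =ᵐ[m] v) : u ∈ (maxScaleForm s m).closureIn (testFunComp t) := by
  have hs := h.coord_left
  have ht := h.coord_right
  obtain ⟨a, b, hab, hvab⟩ := hs.exists_subset_Ioo e hvc
  -- The margin between `[a, b]` and `(a', b')` leaves room for the approximating test functions and
  -- the correcting bump.
  obtain ⟨a', ha'⟩ := hs.exists_lt a
  obtain ⟨b', hb'⟩ := hs.exists_gt b
  have hv0 : ∀ x, x ∉ Ioo a b → v x = 0 := fun x hx =>
    image_eq_zero_of_notMem_tsupport fun h' => hx (hvab h')
  have ha'b' : a' < b' := ha'.trans (hab.trans hb')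
  set Ψ := hψ.toLp ψ
  have hvΨ : ∀ x y : I, x ≤ y → v y - v x = ∫ z in Ioc x y, Ψ z ∂(scaleMeasure s) := by
    intro x y hxy
    rw [hv x y hxy]
    exact integral_congr_ae (ae_restrict_of_ae hψ.coeFn_toLp.symm)
  -- `Ψ` vanishes off the support of `v`
  have hind : ∀ x y : I, x ≤ y → ∫ z in Ioc x y, (Ioc a b).indicator Ψ z ∂(scaleMeasure s) =
      ∫ z in Ioc x y, Ψ z ∂(scaleMeasure s) := by
    intro x y hxy
    rw [setIntegral_indicator measurableSet_Ioc, Ioc_inter_Ioc, ← hvΨ x y hxy]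
    rcases le_total (max x a) (min y b) with hle | hle
    · rw [← hvΨ _ _ hle]
      congr 1
      · rcases le_total y b with hyb | hyb
        · rw [min_eq_left hyb]
        · rw [min_eq_right hyb, hv0 b (by simp), hv0 y fun h' => not_lt.2 hyb h'.2]
      · rcases le_total x a with hxa | hxa
        · rw [max_eq_right hxa, hv0 a (by simp), hv0 x fun h' => not_lt.2 hxa h'.1]
        · rw [max_eq_left hxa]
    · rw [Ioc_eq_empty (not_lt.2 hle), Measure.restrict_empty, integral_zero_measure]
      have hxy' : y ≤ a ∨ b ≤ x ∨ x = y := by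
        rcases le_or_gt y a with h1 | h1
        · exact Or.inl h1
        rcases le_or_gt b x with h2 | h2
        · exact Or.inr (Or.inl h2)
        rcases hxy.lt_or_eq with h3 | h3
        · exact absurd hle (not_le.2 (max_lt (lt_min h3 h2) (lt_min h1 hab)))
        · exact Or.inr (Or.inr h3)
      rcases hxy' with h1 | h1 | rfl
      · rw [hv0 y fun h' => not_lt.2 h1 h'.1, hv0 x fun h' => not_lt.2 (hxy.trans h1) h'.1, sub_zero]
      · rw [hv0 y fun h' => not_lt.2 (h1.trans hxy) h'.2, hv0 x fun h' => not_lt.2 h1 h'.2, sub_zero]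
      · rw [sub_self]
  have hΨ0 : ∀ᵐ x ∂(scaleMeasure s), x ∉ Icc a b → Ψ x = 0 := by
    have := hs.ae_eq_of_forall_Ioc ((Lp.memLp Ψ).indicator measurableSet_Ioc) (Lp.memLp Ψ) hind
    filter_upwards [this] with x hx hxn
    rw [← hx, indicator_of_notMem fun h' => hxn (Ioc_subset_Icc_self h')]
  have hKU : Icc a b ⊆ Ioo a' b' := fun x hx => ⟨ha'.trans_le hx.1, hx.2.trans_lt hb'⟩
  have hsub : 0 ≤ s b' - s a' := sub_nonneg.2 (hs.strictMono.monotone ha'b'.le)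
  -- a bump, used to correct the integral
  obtain ⟨χ, hχ, hχ01, hχ1, hχ0⟩ := ht.exists_cutoff (isCompact_Icc_subtype a b) isOpen_Ioo hKU
  set X := (h.memLp_testFun_mul hχ).toLp _
  have hD : 0 < ∫ x in t a'..t b', χ x := by
    refine intervalIntegral.integral_pos (ht.strictMono ha'b') hχ.1.continuous.continuousOn
      (fun x _ => (hχ01 x).1) ⟨t a, ⟨(ht.strictMono ha').le,
        (ht.strictMono (hab.trans hb')).le⟩, ?_⟩
    rw [hχ1 a ⟨le_rfl, hab.le⟩]
    exact one_pos
  set D := ∫ x in t a'..t b', χ x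
  -- `M` accounts for the approximation error of the derivative plus that of the bump correction;
  -- `N` adds the energy factor `1/2` to the Poincaré constant.
  set M := 1 + √(s b' - s a') / D * ‖X‖
  set N := 1 / 2 + (s b' - s a') * m.real (Icc a' b')
  have key : ∀ δ > 0, ∃ f ∈ testFunComp t, ∃ w ∈ (maxScaleForm s m).domain, w =ᵐ[m] f ∧
      (maxScaleForm s m).energyOne (u - w) ≤ N * (δ * M) ^ 2 := by
    intro δ hδ
    obtain ⟨F₀, hF₀, hle, hF₀0⟩ := h.exists_testFun_norm_sub_le Ψ (isCompact_Icc_subtype a b)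
      isOpen_Ioo hKU hΨ0 hδ
    set Y := (h.memLp_testFun_mul hF₀).toLp _
    -- This multiple of `χ` makes the integral zero, so that the primitive has compact support. It
    -- is small because `Ψ` has integral zero over `(a', b']`, `v` vanishing at both ends; the
    -- integral of `F₀` is thus only the integral of the error.
    set c := (∫ x in t a'..t b', F₀ x) / D
    have hc : |c| ≤ δ * (√(s b' - s a') / D) := by
      have h1 : ∫ x in t a'..t b', F₀ x =
          -∫ z in Ioc a' b', (Ψ - Y : Lp ℝ 2 (scaleMeasure s)) z ∂(scaleMeasure s) := by
        rw [integral_congr_ae (ae_restrict_of_ae (Lp.coeFn_sub Ψ Y))]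
        simp only [Pi.sub_apply]
        rw [integral_sub (hs.integrableOn_Ioc (Lp.memLp _) _ _)
          (hs.integrableOn_Ioc (Lp.memLp _) _ _), ← hvΨ _ _ ha'b'.le,
          hv0 a' fun h' => lt_asymm ha' h'.1, hv0 b' fun h' => lt_asymm hb' h'.2,
          integral_congr_ae (ae_restrict_of_ae (h.memLp_testFun_mul hF₀).coeFn_toLp),
          ← h.setIntegral_eq (fun z => F₀ (t z)), ht.setIntegral_comp,
          intervalIntegral.integral_of_le (ht.strictMono ha'b').le]
        ring
      rw [abs_div, abs_of_pos hD, h1, abs_neg, ← mul_div_assoc]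
      gcongr
      refine (hs.abs_setIntegral_Ioc_le (Lp.memLp _) ha'b'.le).trans ?_
      rw [← Lp.norm_def]
      gcongr
    set F := F₀ + (-c) • χ
    have hFmem : F ∈ testFun (range t) := by
      refine ⟨hF₀.1.add (hχ.1.const_smul (-c)), hF₀.2.1.add (hχ.2.1.smul_left (f := fun _ => -c)),
        (tsupport_add _ _).trans (union_subset hF₀.2.2
          ((tsupport_smul_subset_right (fun _ => -c) χ).trans hχ.2.2))⟩
    have hF0 : ∀ x ∉ Ioo (t a') (t b'), F x = 0 := by
      intro x hx
      by_cases hxr : x ∈ range t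
      · obtain ⟨z, rfl⟩ := hxr
        have hz : z ∉ Ioo a' b' := fun hz => hx ⟨ht.strictMono hz.1, ht.strictMono hz.2⟩
        simp [F, hF₀0 z hz, hχ0 z hz]
      · exact image_eq_zero_of_notMem_tsupport fun h' => hxr (hFmem.2.2 h')
    have hFi : ∫ x in t a'..t b', F x = 0 := by
      have h1 : ∀ x, F x = F₀ x - c * χ x := fun x => by simp [F, sub_eq_add_neg]
      simp_rw [h1]
      rw [intervalIntegral.integral_sub (hF₀.1.continuous.intervalIntegrable _ _)
        ((hχ.1.continuous.intervalIntegrable _ _).const_mul c),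
        intervalIntegral.integral_const_mul, div_mul_cancel₀ _ hD.ne', sub_self]
    have hφ := mem_testFun_integral hFmem.1
      (ht.ordConnected_range.out ⟨a', rfl⟩ ⟨b', rfl⟩) hF0 hFi
    set φ : ℝ → ℝ := fun y => ∫ x in t a'..y, F x
    have hφF : deriv φ = F :=
      funext fun x => (hasDerivAt_integral_of_continuous hFmem.1.continuous _ x).deriv
    have hφm : MemLp (φ ∘ t) 2 m := ht.memLp_testFun_comp hφ
    set w := hφm.toLp _
    have hwd := h.hasScaleDeriv_testFun hφ hφm.coeFn_toLp
    have hwY : HasScaleDeriv s w (Y - c • X : Lp ℝ 2 (scaleMeasure s)) := by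
      refine hwd.congr ?_
      filter_upwards [Lp.coeFn_sub Y (c • X), Lp.coeFn_smul c X,
        (h.memLp_testFun_mul hF₀).coeFn_toLp, (h.memLp_testFun_mul hχ).coeFn_toLp] with x h1 h2 h3 h4
      rw [h1, Pi.sub_apply, h2, Pi.smul_apply, h3, h4, hφF]
      simp only [F, Pi.add_apply, Pi.smul_apply, smul_eq_mul]
      ring
    have huΨ : HasScaleDeriv s u Ψ := ⟨Lp.memLp _, v, hu, hvΨ⟩
    set Δ := Ψ - (Y - c • X)
    have huw : HasScaleDeriv s (u - w) Δ := (huΨ.sub hs hwY).congr (Lp.coeFn_sub _ _).symm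
    have hΔ : ‖Δ‖ ≤ δ * M := by
      have h1 : Δ = (Ψ - Y) + c • X := by simp only [Δ]; abel
      rw [h1]
      refine (norm_add_le _ _).trans ?_
      rw [norm_smul, Real.norm_eq_abs]
      have := mul_le_mul_of_nonneg_right hc (norm_nonneg X)
      simp only [M]
      linarith
    refine ⟨φ ∘ t, ⟨φ, hφ, rfl⟩, w, ⟨_, hwd⟩, hφm.coeFn_toLp, ?_⟩
    have hL2 : ‖u - w‖ ^ 2 ≤ (s b' - s a') * m.real (Icc a' b') * ‖Δ‖ ^ 2 := by
      refine hs.norm_le_of_hasScaleDeriv (w := v - φ ∘ t) ha'b'.le ?_ (fun x y hxy => ?_) ?_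
      · exact (Lp.coeFn_sub u w).trans (hu.sub hφm.coeFn_toLp)
      · rw [integral_congr_ae (ae_restrict_of_ae (Lp.coeFn_sub Ψ (Y - c • X)))]
        simp only [Pi.sub_apply]
        rw [integral_sub (hs.integrableOn_Ioc (Lp.memLp _) _ _)
          (hs.integrableOn_Ioc (Lp.memLp _) _ _), ← hvΨ x y hxy]
        have h1 : ∫ z in Ioc x y, (Y - c • X : Lp ℝ 2 (scaleMeasure s)) z ∂(scaleMeasure s) =
            ∫ z in Ioc x y, deriv φ (t z) * k z ∂(scaleMeasure s) :=
          integral_congr_ae (ae_restrict_of_ae (hwY.ae_eq hs hwd))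
        rw [h1, ← h.setIntegral_eq (fun z => deriv φ (t z)), ← ht.setIntegral_deriv_comp hφ.1 hxy]
        simp only [Function.comp_apply]
        ring
      · intro x hx
        have hφ0 : φ (t x) = 0 := integral_eq_zero_of_notMem_Ioo hFmem.1.continuous hF0 hFi
          fun h' => hx ⟨ht.strictMono.lt_iff_lt.1 h'.1, (ht.strictMono.lt_iff_lt.1 h'.2).le⟩
        rw [Pi.sub_apply, Function.comp_apply, hφ0, hv0 x fun h' =>
          hx ⟨ha'.trans h'.1, (h'.2.trans hb').le⟩, sub_zero]
    rw [L2Form.energyOne, huw.form_toLp_self hs]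
    have h2 : ‖Δ‖ ^ 2 ≤ (δ * M) ^ 2 := pow_le_pow_left₀ (norm_nonneg _) hΔ 2
    have hN : 0 ≤ N := by positivity
    calc 1 / 2 * ‖Δ‖ ^ 2 + ‖u - w‖ ^ 2 ≤ N * ‖Δ‖ ^ 2 := by simp only [N]; linarith
      _ ≤ N * (δ * M) ^ 2 := mul_le_mul_of_nonneg_left h2 hN
  refine ⟨⟨ψ, hψ, v, hu, hv⟩, fun ε hε => ?_⟩
  have hlim : Tendsto (fun δ : ℝ => N * (δ * M) ^ 2) (𝓝[>] 0) (𝓝 0) := by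
    have hcont : Continuous fun δ : ℝ => N * (δ * M) ^ 2 := by fun_prop
    have := (hcont.tendsto 0).mono_left (nhdsWithin_le_nhds (s := Ioi 0))
    simpa using this
  obtain ⟨δ, hδε, hδ⟩ := (((tendsto_order.1 hlim).2 ε hε).and self_mem_nhdsWithin).exists
  obtain ⟨f, hf, w, hw, hwf, hle⟩ := key δ hδ
  exact ⟨f, hf, w, hw, hwf, hle.trans_lt hδε⟩

end HasSqDensity

end Density

/-! ### The absolutely continuous part of a scale -/

section AbsolutelyContinuousPart

open Topology

variable {I : Set ℝ} [I.OrdConnected] {s t : I → ℝ} {m : Measure I}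

/-- A test function of `t` has compact support and derivative `φ'(t) k ∈ L²(ds)`, so it is
approximated by the test functions of any other such coordinate. Applied in both directions, this
identifies the two closures. -/
theorem HasSqDensity.closureIn_testFunComp_subset [m.IsOpenPosMeasure]
    [IsFiniteMeasureOnCompacts m] {t' : I → ℝ} {k k' : I → NNReal} (h : HasSqDensity s t k)
    (h' : HasSqDensity s t' k') (e : I) :
    (maxScaleForm s m).closureIn (testFunComp t) ⊆ (maxScaleForm s m).closureIn (testFunComp t') := by
  refine (h.coord_left.isClosedForm_maxScaleForm e).closureIn_subset ?_
  rintro _ ⟨φ, hφ, rfl⟩ w - hw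
  refine h'.mem_closureIn_testFunComp e (h.coord_right.hasCompactSupport_comp hφ)
    (h.memLp_testFun_mul (deriv_mem_testFun hφ)) (fun x y hxy => ?_) hw
  rw [← h.setIntegral_eq (fun z => deriv φ (t z))]
  exact h.coord_right.setIntegral_deriv_comp hφ.1 hxy

/-- If the test functions of the coordinate `t` are in the domain of the form with scale `s`, then
`t` is locally absolutely continuous with respect to `s` with a density in `L²(ds)`. -/
theorem IsCoord.exists_memLp_of_mem [m.IsOpenPosMeasure] (hs : IsCoord s) (ht : IsCoord t)
    (h : ∀ f ∈ testFunComp t, (maxScaleForm s m).Mem f) (a b : I) :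
    ∃ ψ, MemLp ψ 2 (scaleMeasure s) ∧ ∀ x y : I, a ≤ x → x ≤ y → y ≤ b →
      t y - t x = ∫ z in Ioc x y, ψ z ∂(scaleMeasure s) := by
  obtain ⟨χ, hχ, -, hχ1, -⟩ := ht.exists_cutoff (isCompact_Icc_subtype a b) isOpen_univ
    (subset_univ _)
  -- The identity cut off: its composition with `t` coincides with `t` on `[a, b]`.
  have hφ : (fun r => r * χ r) ∈ testFun (range t) :=
    ⟨contDiff_id.mul hχ.1, hχ.2.1.mul_left (f := fun r => r),
      (tsupport_mul_subset_right (f := fun r : ℝ => r)).trans hχ.2.2⟩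
  obtain ⟨w, ⟨ψ, hψ, v, hwv, hv⟩, hwf⟩ := h _ ⟨_, hφ, rfl⟩
  have hvt : v = (fun r => r * χ r) ∘ t := ((hs.continuous_of_scaleDeriv hψ hv).ae_eq_iff_eq m
    (hφ.1.continuous.comp ht.continuous)).1 (hwv.symm.trans hwf)
  have hvt' : ∀ x ∈ Icc a b, v x = t x := fun x hx => by simp [hvt, hχ1 x hx]
  refine ⟨ψ, hψ, fun x y hax hxy hyb => ?_⟩
  rw [← hv x y hxy, hvt' x ⟨hax, hxy.trans hyb⟩, hvt' y ⟨hax.trans hxy, hyb⟩]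

variable {e : I}

theorem IsCoord.sigmaFinite (hs : IsCoord s) : SigmaFinite (scaleMeasure s) := by
  have := hs.isLocallyFiniteMeasure
  infer_instance

theorem IsCoord.integrableOn_acDensity (hs : IsCoord s) (x y : I) :
    IntegrableOn (acDensity s) (Ioc x y) (lebesgueOn I) :=
  integrable_toReal_of_lintegral_ne_top (Measure.measurable_rnDeriv _ _).aemeasurable
    ((Measure.setLIntegral_rnDeriv_le _).trans_lt (hs.scaleMeasure_Ioc_lt_top x y)).ne

theorem IsCoord.ofReal_acDensity (hs : IsCoord s) :
    ∀ᵐ x ∂(lebesgueOn I), ENNReal.ofReal (acDensity s x) =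
      (scaleMeasure s).rnDeriv (lebesgueOn I) x := by
  have := hs.sigmaFinite
  filter_upwards [Measure.rnDeriv_lt_top (scaleMeasure s) (lebesgueOn I)] with x hx
  exact ENNReal.ofReal_toReal hx.ne

theorem IsCoord.acPart_sub (hs : IsCoord s) {x y : I} (hxy : x ≤ y) :
    acPart e s y - acPart e s x = ∫ z in Ioc x y, acDensity s z ∂(lebesgueOn I) := by
  have hadd : ∀ a b c : I, a ≤ b → b ≤ c → ∫ z in Ioc a c, acDensity s z ∂(lebesgueOn I) =
      (∫ z in Ioc a b, acDensity s z ∂(lebesgueOn I)) +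
        ∫ z in Ioc b c, acDensity s z ∂(lebesgueOn I) := by
    intro a b c hab hbc
    rw [← Ioc_union_Ioc_eq_Ioc hab hbc]
    exact setIntegral_union (Set.disjoint_left.2 fun z h1 h2 => not_lt.2 h1.2 h2.1)
      measurableSet_Ioc (hs.integrableOn_acDensity _ _) (hs.integrableOn_acDensity _ _)
  have hem : ∀ a b : I, a ≤ b → ∫ z in Ioc b a, acDensity s z ∂(lebesgueOn I) = 0 := by
    intro a b hab
    rw [Ioc_eq_empty (not_lt.2 hab)]
    simp
  unfold acPart
  rcases le_total e x with h1 | h1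
  · rw [hem e x h1, hem e y (h1.trans hxy), hadd e x y h1 hxy]
    ring
  · rcases le_total e y with h2 | h2
    · rw [hem e y h2, hem x e h1, hadd x e y h1 h2]
      ring
    · rw [hem x e h1, hem y e h2, hadd x y e hxy h2]
      ring

theorem IsCoord.setIntegral_acDensity_le (hs : IsCoord s) {x y : I} (hxy : x ≤ y) :
    ∫ z in Ioc x y, acDensity s z ∂(lebesgueOn I) ≤ s y - s x := by
  have := hs.sigmaFinite
  have h1 := integral_toReal (μ := (lebesgueOn I).restrict (Ioc x y))
    (Measure.measurable_rnDeriv (scaleMeasure s) (lebesgueOn I)).aemeasurable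
    (ae_restrict_of_ae (Measure.rnDeriv_lt_top _ _))
  have h2 := ENNReal.toReal_mono (hs.scaleMeasure_Ioc_lt_top x y).ne
    (Measure.setLIntegral_rnDeriv_le (μ := scaleMeasure s) (ν := lebesgueOn I) (Ioc x y))
  rw [hs.scaleMeasure_Ioc, ENNReal.toReal_ofReal
    (sub_nonneg.2 (hs.strictMono.monotone hxy))] at h2
  exact h1.le.trans h2

theorem acDensity_nonneg (s : I → ℝ) (x : I) : 0 ≤ acDensity s x := ENNReal.toReal_nonneg

/-- The absolutely continuous part of a scale is a scale if its density does not vanish. -/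
theorem IsCoord.isScale_acPart (hs : IsCoord s)
    (hpos : ∀ᵐ x ∂(lebesgueOn I), acDensity s x ≠ 0) : IsScale e (acPart e s) where
  strictMono x y hxy := by
    rw [← sub_pos, hs.acPart_sub hxy.le, setIntegral_pos_iff_support_of_nonneg_ae
      (Eventually.of_forall (acDensity_nonneg s)) (hs.integrableOn_acDensity x y)]
    have h1 : lebesgueOn I (Ioc x y) ≠ 0 := by
      rw [lebesgueOn_eq, (isCoord_val hs.isOpen).scaleMeasure_Ioc]
      simpa using hxy
    have h2 : lebesgueOn I (Function.support (acDensity s))ᶜ = 0 := by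
      rw [ae_iff] at hpos
      exact hpos
    refine pos_iff_ne_zero.2 fun h0 => h1 (measure_mono_null (fun z hz => ?_)
      (measure_union_null h0 h2))
    by_cases hz' : z ∈ Function.support (acDensity s)
    · exact Or.inl ⟨hz', hz⟩
    · exact Or.inr hz'
  continuous := by
    -- Continuity is inherited from `s`, whose increments dominate those of its absolutely
    -- continuous part.
    have hle : ∀ x y : I, |acPart e s y - acPart e s x| ≤ |s y - s x| := by
      have : ∀ x y : I, x ≤ y → |acPart e s y - acPart e s x| ≤ |s y - s x| := fun x y hxy => by
        rw [hs.acPart_sub hxy, abs_of_nonneg (sub_nonneg.2 (hs.strictMono.monotone hxy)),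
          abs_of_nonneg (integral_nonneg (acDensity_nonneg s))]
        exact hs.setIntegral_acDensity_le hxy
      intro x y
      rcases le_total x y with hxy | hxy
      · exact this x y hxy
      · rw [abs_sub_comm, abs_sub_comm (s y)]
        exact this y x hxy
    refine continuous_iff_continuousAt.2 fun x => ?_
    rw [ContinuousAt, tendsto_iff_norm_sub_tendsto_zero]
    refine squeeze_zero (fun y => norm_nonneg _) (fun y => hle x y) ?_
    have hc : Continuous fun y => |s y - s x| := (hs.continuous.sub continuous_const).abs
    simpa using hc.tendsto x
  base := by simp [acPart]

theorem IsCoord.scaleMeasure_acPart (hs : IsCoord s) (h : IsCoord (acPart e s)) :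
    scaleMeasure (acPart e s) =
      (lebesgueOn I).withDensity ((scaleMeasure s).rnDeriv (lebesgueOn I)) := by
  have : NoMinOrder I := ⟨hs.exists_lt⟩
  refine Measure.ext_of_Ioc' _ _ (fun a b _ => (h.scaleMeasure_Ioc_lt_top a b).ne)
    fun a b hab => ?_
  rw [h.scaleMeasure_Ioc, hs.acPart_sub hab.le, withDensity_apply _ measurableSet_Ioc,
    ofReal_integral_eq_lintegral_ofReal (hs.integrableOn_acDensity a b)
    (Eventually.of_forall (acDensity_nonneg s))]
  exact lintegral_congr_ae (ae_restrict_of_ae hs.ofReal_acDensity)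

/-- The absolutely continuous part of `ds` is the restriction of `ds` to a set. -/
theorem IsCoord.exists_withDensity_eq_restrict (hs : IsCoord s) : ∃ A : Set I, MeasurableSet A ∧
    lebesgueOn I Aᶜ = 0 ∧
    (lebesgueOn I).withDensity ((scaleMeasure s).rnDeriv (lebesgueOn I)) =
      (scaleMeasure s).restrict A := by
  have := hs.sigmaFinite
  have : SigmaFinite (lebesgueOn I) := (isCoord_val hs.isOpen).sigmaFinite
  -- `A` is null for the singular part and has Lebesgue-null complement, so restricting `ds` to it
  -- leaves exactly `g λ`.
  obtain ⟨A, hA, h1, h2⟩ := Measure.mutuallySingular_singularPart (scaleMeasure s) (lebesgueOn I)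
  refine ⟨A, hA, h2, ?_⟩
  have h3 := Measure.haveLebesgueDecomposition_add (scaleMeasure s) (lebesgueOn I)
  conv_rhs => rw [h3]
  rw [Measure.restrict_add, Measure.restrict_eq_zero.2 h1, zero_add,
    Measure.restrict_eq_self_of_ae_mem]
  exact (withDensity_absolutelyContinuous _ _) h2

/-- If Lebesgue measure is locally absolutely continuous with respect to `ds`, with density `ψ`,
then `ψ` is the reciprocal of the density of `ds`. -/
theorem IsCoord.ae_acDensity_mul_eq_one (hs : IsCoord s) {a b : I} (hab : a ≤ b) {ψ : I → ℝ}
    (hψ : MemLp ψ 2 (scaleMeasure s)) (h : ∀ x y : I, a ≤ x → x ≤ y → y ≤ b →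
      (y : ℝ) - x = ∫ z in Ioc x y, ψ z ∂(scaleMeasure s)) :
    ∀ᵐ x ∂(lebesgueOn I), x ∈ Ioc a b → acDensity s x * ψ x = 1 := by
  have := hs.sigmaFinite
  have hval := isCoord_val hs.isOpen
  have hfin : ∀ x y : I, lebesgueOn I (Ioc x y) ≠ ⊤ := fun x y =>
    (hval.scaleMeasure_Ioc_lt_top x y).ne
  obtain ⟨A, hA, hA0, hAeq⟩ := hs.exists_withDensity_eq_restrict
  have hψi := hs.integrableOn_Ioc hψ a b
  have hone : IntegrableOn (fun _ => (1 : ℝ)) (Ioc a b) (lebesgueOn I) :=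
    integrableOn_const (hfin a b)
  have hB : ∀ B, MeasurableSet B → B ⊆ Ioc a b →
      ∫ _ in B, (1 : ℝ) ∂(lebesgueOn I) = ∫ z in B, ψ z ∂(scaleMeasure s) := fun B hB hBab =>
    setIntegral_eq_of_forall_Ioc hab hone hψi (fun x y h1 h2 h3 => by
      rw [← h x y h1 h2 h3, setIntegral_const, Measure.real, lebesgueOn_eq, hval.scaleMeasure_Ioc,
        ENNReal.toReal_ofReal (sub_nonneg.2 h2)]
      simp) hB hBab
  have hG := Measure.measurable_rnDeriv (scaleMeasure s) (lebesgueOn I)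
  have hGlt := Measure.rnDeriv_lt_top (scaleMeasure s) (lebesgueOn I)
  have hint : IntegrableOn (fun x => acDensity s x * ψ x) (Ioc a b) (lebesgueOn I) := by
    have h1 : IntegrableOn ψ (Ioc a b) ((scaleMeasure s).restrict A) := by
      rw [IntegrableOn, Measure.restrict_restrict measurableSet_Ioc]
      exact hψi.mono_set inter_subset_left
    rw [← hAeq, IntegrableOn, restrict_withDensity measurableSet_Ioc,
      integrable_withDensity_iff_integrable_smul' hG (ae_restrict_of_ae hGlt)] at h1
    exact h1
  rw [← ae_restrict_iff' measurableSet_Ioc]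
  refine Integrable.ae_eq_of_forall_setIntegral_eq _ _ hint hone fun B hBm _ => ?_
  rw [Measure.restrict_restrict hBm]
  set B' := B ∩ Ioc a b
  have hB'm : MeasurableSet B' := hBm.inter measurableSet_Ioc
  -- As `A` has full Lebesgue measure, `λ(B') = λ(B' ∩ A)`. The latter is the `ds`-integral of `ψ`
  -- over `B' ∩ A`, which sees only the absolutely continuous part of `ds`.
  have h1 : ∫ x in B', acDensity s x * ψ x ∂(lebesgueOn I) =
      ∫ z in B' ∩ A, ψ z ∂(scaleMeasure s) := by
    rw [← Measure.restrict_restrict hB'm, ← hAeq, setIntegral_withDensity_eq_setIntegral_toReal_smul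
      hG (ae_restrict_of_ae hGlt) _ hB'm]
    rfl
  rw [h1, ← hB _ (hB'm.inter hA) (inter_subset_left.trans inter_subset_right)]
  refine setIntegral_congr_set (inter_ae_eq_left_of_ae_eq_univ ?_)
  exact eventuallyEq_univ.2 hA0

section Dirichlet

variable [m.IsOpenPosMeasure]

theorem IsCoord.exists_ae_acDensity_mul_eq_one (hs : IsCoord s)
    (hC : ∀ f ∈ testFunOn I, (maxScaleForm s m).Mem f) {a b : I} (hab : a ≤ b) :
    ∃ ψ, MemLp ψ 2 (scaleMeasure s) ∧
      ∀ᵐ x ∂(lebesgueOn I), x ∈ Ioc a b → acDensity s x * ψ x = 1 := by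
  obtain ⟨ψ, hψ, h⟩ := hs.exists_memLp_of_mem (isCoord_val hs.isOpen)
    (fun f hf => hC f (testFunOn_eq I ▸ hf)) a b
  exact ⟨ψ, hψ, hs.ae_acDensity_mul_eq_one hab hψ h⟩

theorem IsCoord.ae_acDensity_ne_zero (hs : IsCoord s)
    (hC : ∀ f ∈ testFunOn I, (maxScaleForm s m).Mem f) :
    ∀ᵐ x ∂(lebesgueOn I), acDensity s x ≠ 0 := by
  refine measure_null_of_locally_null _ fun x _ => ?_
  obtain ⟨a, b, hx⟩ := hs.exists_Ioo_mem x
  obtain ⟨ψ, -, h⟩ := hs.exists_ae_acDensity_mul_eq_one hC (hx.1.trans hx.2).le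
  refine ⟨{z | acDensity s z ≠ 0}ᶜ ∩ Ioc a b, inter_mem_nhdsWithin _
    (mem_of_superset (Ioo_mem_nhds hx.1 hx.2) Ioo_subset_Ioc_self), ?_⟩
  refine measure_mono_null (fun z hz => ?_) h
  intro hz'
  have h1 : acDensity s z = 0 := not_not.1 hz.1
  have := hz' hz.2
  simp [h1] at this

/-- Lebesgue measure has a locally square integrable density with respect to the absolutely
continuous part of `s`. -/
theorem IsCoord.hasSqDensity_acPart (hs : IsCoord s)
    (hC : ∀ f ∈ testFunOn I, (maxScaleForm s m).Mem f) :
    HasSqDensity (acPart e s) Subtype.val fun x => (acDensity s x).toNNReal⁻¹ := by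
  have hne := hs.ae_acDensity_ne_zero hC
  have hc := (hs.isScale_acPart (e := e) hne).isCoord hs.isOpen
  have hμ := hs.scaleMeasure_acPart hc
  have hG := Measure.measurable_rnDeriv (scaleMeasure s) (lebesgueOn I)
  have hmeas : Measurable fun x => (acDensity s x).toNNReal⁻¹ := hG.ennreal_toReal.real_toNNReal.inv
  have hac : scaleMeasure (acPart e s) ≪ lebesgueOn I :=
    hμ ▸ withDensity_absolutelyContinuous _ _
  refine ⟨hc, isCoord_val hs.isOpen, hmeas, ?_, ?_, fun a b => ?_⟩
  · filter_upwards [hac.ae_le hne] with x hx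
    simpa using lt_of_le_of_ne (acDensity_nonneg s x) hx.symm
  · rw [hμ, ← withDensity_mul _ hG hmeas.coe_nnreal_ennreal, ← lebesgueOn_eq]
    conv_lhs => rw [← withDensity_one (μ := lebesgueOn I)]
    refine withDensity_congr_ae ?_
    filter_upwards [hne, hs.ofReal_acDensity] with x h1 h2
    have h3 : (acDensity s x).toNNReal ≠ 0 := by
      simpa using lt_of_le_of_ne (acDensity_nonneg s x) h1.symm
    rw [Pi.mul_apply, ← h2, ENNReal.ofReal, ← ENNReal.coe_mul, mul_inv_cancel₀ h3]
    rfl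
  · rcases le_or_gt b a with hab | hab
    · rw [Ioc_eq_empty (not_lt.2 hab)]
      simp
    obtain ⟨ψ, hψ, h⟩ := hs.exists_ae_acDensity_mul_eq_one hC hab.le
    obtain ⟨A, hA, hA0, hAeq⟩ := hs.exists_withDensity_eq_restrict
    -- On `(a, b]` the density `1/g` equals `ψ` a.e., and `ψ` is square integrable for `ds`, which
    -- dominates `ds̄`.
    calc ∫⁻ x in Ioc a b, (((acDensity s x).toNNReal⁻¹ ^ 2 : NNReal) : ℝ≥0∞)
          ∂(scaleMeasure (acPart e s))
        ≤ ∫⁻ x in Ioc a b, ‖ψ x‖ₑ ^ 2 ∂(scaleMeasure (acPart e s)) := by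
          refine lintegral_mono_ae ?_
          rw [ae_restrict_iff' measurableSet_Ioc]
          filter_upwards [hac.ae_le h] with x hx hxab
          have h1 := hx hxab
          have h2 : ψ x = (acDensity s x)⁻¹ := eq_inv_of_mul_eq_one_right h1
          rw [h2, ENNReal.coe_pow, enorm_eq_nnnorm, nnnorm_inv]
          simp [Real.toNNReal_of_nonneg (acDensity_nonneg s x), Real.nnnorm_of_nonneg
            (acDensity_nonneg s x)]
      _ ≤ ∫⁻ x, ‖ψ x‖ₑ ^ 2 ∂(scaleMeasure s) := by
          rw [hμ, hAeq]
          exact lintegral_mono' (Measure.restrict_le_self.trans Measure.restrict_le_self) le_rfl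
      _ < ⊤ := by
          have := (eLpNorm_lt_top_iff_lintegral_rpow_enorm_lt_top (by simp) (by simp)).1 hψ.2
          simpa using this

/-- The part of `ds` off `A` is not seen by `dt`, so a derivative equal to zero there has the same
integrals. -/
theorem HasScaleDeriv.of_restrict {A : Set I} (hA : MeasurableSet A)
    (h : scaleMeasure t = (scaleMeasure s).restrict A) {u : Lp ℝ 2 m} {φ : I → ℝ}
    (hu : HasScaleDeriv t u φ) : HasScaleDeriv s u (A.indicator φ) := by
  obtain ⟨h1, v, h2, h3⟩ := hu
  refine ⟨(memLp_indicator_iff_restrict hA).2 (h ▸ h1), v, h2, fun x y hxy => ?_⟩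
  rw [h3 x y hxy, h, setIntegral_indicator hA, Measure.restrict_restrict measurableSet_Ioc]

/-- If `dt` is a restriction of `ds`, then the form of `s` extends that of `t`. -/
theorem IsCoord.maxScaleForm_extends (hs : IsCoord s) (ht : IsCoord t) {A : Set I}
    (hA : MeasurableSet A) (h : scaleMeasure t = (scaleMeasure s).restrict A) :
    (maxScaleForm s m).Extends (maxScaleForm t m) := by
  refine ⟨?_, ?_⟩
  · rintro u ⟨φ, hφ⟩
    exact ⟨_, hφ.of_restrict hA h⟩
  · rintro u ⟨φ, hφ⟩ v ⟨ψ, hψ⟩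
    rw [hφ.form_eq ht hψ, (hφ.of_restrict hA h).form_eq hs (hψ.of_restrict hA h), h,
      ← integral_indicator hA]
    simp only [indicator_mul]

end Dirichlet

end AbsolutelyContinuousPart

/-! ### Absolutely continuous scales -/

section LocallyAbsolutelyContinuous

open Topology

variable {I : Set ℝ} [I.OrdConnected] {s : I → ℝ} {e : I}

theorem extend_val_apply (f : I → ℝ) (g : ℝ → ℝ) (x : I) :
    Function.extend Subtype.val f g x = f x :=
  Subtype.val_injective.extend_apply f g x

theorem setIntegral_lebesgueOn_Ioc (hI : IsOpen I) (F : ℝ → ℝ) {x y : I} (hxy : x ≤ y) :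
    ∫ z in Ioc x y, F z ∂(lebesgueOn I) = ∫ z in (x : ℝ)..y, F z := by
  rw [lebesgueOn_eq, (isCoord_val hI).setIntegral_comp F, intervalIntegral.integral_of_le]
  exact hxy

theorem integrableOn_lebesgueOn_Ioc_iff (hI : IsOpen I) (F : ℝ → ℝ) (x y : I) :
    IntegrableOn (fun z : I => F z) (Ioc x y) (lebesgueOn I) ↔
      IntegrableOn F (Ioc (x : ℝ) y) := by
  have h := isCoord_val hI
  have h1 := h.measurableEmbedding.integrableOn_map_iff (f := F) (μ := lebesgueOn I)
    (s := Ioc (x : ℝ) y)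
  rw [h.preimage_Ioc, lebesgueOn, h.measurableEmbedding.map_comap, IntegrableOn,
    Measure.restrict_restrict measurableSet_Ioc, inter_eq_left.2 (h.Ioc_subset_range x y)] at h1
  exact h1.symm

theorem absolutelyContinuousOnInterval_congr {f g : ℝ → ℝ} {a b : ℝ}
    (h : ∀ x ∈ uIcc a b, f x = g x) (hf : AbsolutelyContinuousOnInterval f a b) :
    AbsolutelyContinuousOnInterval g a b := by
  rw [absolutelyContinuousOnInterval_iff] at hf ⊢
  intro ε hε
  obtain ⟨δ, hδ, hf⟩ := hf ε hε
  refine ⟨δ, hδ, fun E hE hlt => ?_⟩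
  have := hf E hE hlt
  rwa [Finset.sum_congr rfl fun i hi => by rw [h _ (hE.1 i hi).1, h _ (hE.1 i hi).2]] at this

/-- A function that is locally an integral is absolutely continuous. -/
theorem isACOn_of_setIntegral (hI : IsOpen I)
    (h : ∀ a b : I, a ≤ b → ∃ f : I → ℝ, IntegrableOn f (Ioc a b) (lebesgueOn I) ∧
      ∀ x, a ≤ x → x ≤ b → s x - s a = ∫ z in Ioc a x, f z ∂(lebesgueOn I)) : IsACOn s := by
  intro a b hab
  obtain ⟨f, hf, hfs⟩ := h a b hab
  have hab' : (a : ℝ) ≤ b := hab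
  set F : ℝ → ℝ := Function.extend Subtype.val f 0
  have hFf : ∀ z : I, F z = f z := extend_val_apply f 0
  have hF : IntegrableOn F (Ioc (a : ℝ) b) := by
    rw [← integrableOn_lebesgueOn_Ioc_iff hI]
    simpa only [hFf] using hf
  have hac := (intervalIntegrable_iff_integrableOn_Ioc_of_le hab').2 hF
    |>.absolutelyContinuousOnInterval_intervalIntegral (c := a) left_mem_uIcc
  have hconst : AbsolutelyContinuousOnInterval (fun _ : ℝ => s a) a b :=
    (contDiff_const (n := 1)).contDiffOn.absolutelyContinuousOnInterval
  refine absolutelyContinuousOnInterval_congr (fun x hx => ?_) (hac.add hconst)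
  rw [uIcc_of_le hab'] at hx
  obtain ⟨x, rfl⟩ : ∃ x' : I, (x' : ℝ) = x :=
    ⟨⟨x, Set.OrdConnected.out ‹_› a.2 b.2 hx⟩, rfl⟩
  rw [extend_val_apply, Pi.add_apply, ← setIntegral_lebesgueOn_Ioc hI F hx.1]
  simp only [hFf]
  rw [← hfs x hx.1 hx.2]
  ring

/-- If `s` is absolutely continuous, then so is `ds`. -/
theorem IsCoord.scaleMeasure_absolutelyContinuous (hs : IsCoord s) (h : IsACOn s) :
    scaleMeasure s ≪ lebesgueOn I := by
  intro N hN
  refine measure_null_of_locally_null _ fun x _ => ?_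
  obtain ⟨a, b, hx⟩ := hs.exists_Ioo_mem x
  have hab : a ≤ b := (hx.1.trans hx.2).le
  have hab' : (a : ℝ) ≤ b := hab
  refine ⟨N ∩ Ioc a b, inter_mem_nhdsWithin _
    (mem_of_superset (Ioo_mem_nhds hx.1 hx.2) Ioo_subset_Ioc_self), ?_⟩
  set S := Function.extend Subtype.val s fun _ => 0
  have hac : AbsolutelyContinuousOnInterval S a b := h a b hab
  have hS : ∀ z : I, S z = s z := extend_val_apply s _
  have hint : IntegrableOn (fun z : I => deriv S z) (Ioc a b) (lebesgueOn I) := by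
    rw [integrableOn_lebesgueOn_Ioc_iff hs.isOpen,
      ← intervalIntegrable_iff_integrableOn_Ioc_of_le hab']
    exact hac.intervalIntegrable_deriv
  -- The fundamental theorem of calculus for absolutely continuous functions gives `ds = S' λ` on
  -- intervals, hence on all measurable subsets of `(a, b]`.
  have hμ : ∀ B : Set I, MeasurableSet B → B ⊆ Ioc a b →
      ∫ _ in B, (1 : ℝ) ∂(scaleMeasure s) = ∫ z in B, deriv S z ∂(lebesgueOn I) :=
    fun B hB hBab => setIntegral_eq_of_forall_Ioc hab
      (integrableOn_const (hs.scaleMeasure_Ioc_lt_top a b).ne) hint (fun x y hax hxy hyb => by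
        have hsub : uIcc (x : ℝ) y ⊆ uIcc (a : ℝ) b := by
          rw [uIcc_of_le hab', uIcc_of_le (show (x : ℝ) ≤ y from hxy)]
          exact Icc_subset_Icc hax hyb
        rw [setIntegral_lebesgueOn_Ioc hs.isOpen _ hxy, (hac.mono hsub).integral_deriv_eq_sub,
          hS, hS, setIntegral_const, Measure.real, hs.scaleMeasure_Ioc,
          ENNReal.toReal_ofReal (sub_nonneg.2 (hs.strictMono.monotone hxy))]
        simp) hB hBab
  -- The null set `N` need not be measurable; it is replaced by a measurable null superset.
  set B := toMeasurable (lebesgueOn I) N ∩ Ioc a b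
  have hB : MeasurableSet B := (measurableSet_toMeasurable _ _).inter measurableSet_Ioc
  have hB0 : lebesgueOn I B = 0 := measure_mono_null inter_subset_left (by
    rw [measure_toMeasurable, hN])
  have h1 := hμ B hB inter_subset_right
  rw [Measure.restrict_eq_zero.2 hB0, integral_zero_measure, setIntegral_const, smul_eq_mul,
    mul_one, Measure.real, ENNReal.toReal_eq_zero_iff] at h1
  have h2 : scaleMeasure s B = 0 := h1.resolve_right
    ((measure_mono inter_subset_right).trans_lt (hs.scaleMeasure_Ioc_lt_top a b)).ne
  exact measure_mono_null (inter_subset_inter_left _ (subset_toMeasurable _ _)) h2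

/-- An absolutely continuous scale is its absolutely continuous part. -/
theorem IsScale.acPart_eq (hs : IsScale e s) (hI : IsOpen I) (h : IsACOn s)
    (hc : IsCoord (acPart e s)) : acPart e s = s := by
  have hs' := hs.isCoord hI
  obtain ⟨A, hA, hA0, hAeq⟩ := hs'.exists_withDensity_eq_restrict
  have hμ : scaleMeasure (acPart e s) = scaleMeasure s := by
    rw [hs'.scaleMeasure_acPart hc, hAeq, Measure.restrict_eq_self_of_ae_mem]
    exact hs'.scaleMeasure_absolutelyContinuous h hA0
  have hbase : acPart e s e = 0 := by simp [acPart]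
  have hsub : ∀ x y : I, x ≤ y → acPart e s y - acPart e s x = s y - s x := by
    intro x y hxy
    have h1 := hc.scaleMeasure_Ioc x y
    rw [hμ, hs'.scaleMeasure_Ioc, ENNReal.ofReal_eq_ofReal_iff
      (sub_nonneg.2 (hs.strictMono.monotone hxy))
      (sub_nonneg.2 (hc.strictMono.monotone hxy))] at h1
    exact h1.symm
  ext x
  rcases le_total e x with hx | hx
  · have := hsub e x hx
    rwa [hbase, hs.base, sub_zero, sub_zero] at this
  · have := hsub x e hx
    rw [hbase, hs.base] at this
    linarith

variable {m : Measure I} [m.IsOpenPosMeasure]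

/-- If the test functions of the scale `s` are in the domain of the form whose scale is the
absolutely continuous part of `s`, then `s` is absolutely continuous. -/
theorem IsCoord.isACOn_of_mem (hs : IsCoord s) (hc : IsCoord (acPart e s))
    (h : ∀ f ∈ testFunComp s, (maxScaleForm (acPart e s) m).Mem f) : IsACOn s := by
  have := hs.sigmaFinite
  have hG := Measure.measurable_rnDeriv (scaleMeasure s) (lebesgueOn I)
  have hGlt := Measure.rnDeriv_lt_top (scaleMeasure s) (lebesgueOn I)
  refine isACOn_of_setIntegral hs.isOpen fun a b hab => ?_
  obtain ⟨ψ, hψ, hψs⟩ := hc.exists_memLp_of_mem hs h a b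
  -- Locally `ds = ψ ds̄` and `ds̄ = g λ`, so the Lebesgue density of `ds` is `g ψ`.
  refine ⟨fun x => acDensity s x * ψ x, ?_, fun x hax hxb => ?_⟩
  · have h1 := hc.integrableOn_Ioc hψ a b
    rwa [hs.scaleMeasure_acPart hc, IntegrableOn, restrict_withDensity measurableSet_Ioc,
      integrable_withDensity_iff_integrable_smul' hG (ae_restrict_of_ae hGlt)] at h1
  · rw [hψs a x le_rfl hax hxb, hs.scaleMeasure_acPart hc,
      setIntegral_withDensity_eq_setIntegral_toReal_smul hG (ae_restrict_of_ae hGlt) _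
        measurableSet_Ioc]
    rfl

end LocallyAbsolutelyContinuous

/-! ### The main theorem -/

theorem theorem2p2 (I : Set ℝ) (hI : IsOpen I) (hI' : I.OrdConnected) (e : I)
    (m : Measure I) [IsFiniteMeasureOnCompacts m] [m.IsOpenPosMeasure]
    (s : I → ℝ) (hs : IsScale e s)
    (hC : ∀ f ∈ testFunOn I, (scaleForm s m).Mem f) :
    IsScale e (acPart e s) ∧
    (scaleForm (acPart e s) m).domain = (scaleForm s m).closureIn (testFunOn I) ∧
    (scaleForm (acPart e s) m).IsSmallestClosedExtension
      ((scaleForm s m).restrict (testFunOn I)) ∧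
    (scaleForm (acPart e s) m).IsRegularDirichletSubspace (scaleForm s m) ∧
    ((scaleForm s m).IsSpecialStandardCore (testFunOn I) ↔ IsACOn s) := by
  have hsc := hs.isCoord hI
  have hval := isCoord_val hI
  have hCmax : ∀ f ∈ testFunOn I, (maxScaleForm s m).Mem f := fun f hf => by
    obtain ⟨w, hw, hwf⟩ := hC f hf
    exact ⟨w, hw.1, hwf⟩
  have hbar : IsScale e (acPart e s) := hsc.isScale_acPart (hsc.ae_acDensity_ne_zero hCmax)
  have hbc := hbar.isCoord hI
  have hval_bar := hsc.hasSqDensity_acPart (e := e) hCmax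
  have hmax := hsc.isClosedForm_maxScaleForm (m := m) e
  have hmax_bar := hbc.isClosedForm_maxScaleForm (m := m) e
  have hform := hsc.isClosedForm_scaleForm (m := m) e
  obtain ⟨A, hA, hA0, hAeq⟩ := hsc.exists_withDensity_eq_restrict
  have hext : (maxScaleForm s m).Extends (maxScaleForm (acPart e s) m) :=
    hsc.maxScaleForm_extends hbc hA ((hsc.scaleMeasure_acPart hbc).trans hAeq)
  have hCbar : ∀ f ∈ testFunOn I, (maxScaleForm (acPart e s) m).Mem f := by
    rw [testFunOn_eq]
    rintro _ ⟨φ, hφ, rfl⟩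
    have hm : MemLp (φ ∘ Subtype.val) 2 m := hval.memLp_testFun_comp hφ
    exact ⟨hm.toLp _, ⟨_, hval_bar.hasScaleDeriv_testFun hφ hm.coeFn_toLp⟩, hm.coeFn_toLp⟩
  have hdom : (scaleForm (acPart e s) m).domain = (scaleForm s m).closureIn (testFunOn I) := by
    -- The closure of `C_c^∞(I)` is moved from the form of `s` to its maximal form and then down to
    -- the maximal form of `s̄`, where both families are test functions of coordinates with square
    -- integrable density.
    rw [← hform.closureIn_eq_of_extends hmax (L2Form.extends_closureForm _ _) hC,
      hmax_bar.closureIn_eq_of_extends hmax hext hCbar, testFunOn_eq]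
    exact (hbc.hasSqDensity_self.closureIn_testFunComp_subset hval_bar e).antisymm
      (hval_bar.closureIn_testFunComp_subset hbc.hasSqDensity_self e)
  have hsub : (scaleForm s m).Extends (scaleForm (acPart e s) m) :=
    ⟨fun u hu => (hdom ▸ hu : u ∈ (scaleForm s m).closureIn (testFunOn I)).1,
      fun u hu v hv => hext.2 u hu.1 v hv.1⟩
  have hlin : IsLinearSpace (testFunOn I) := by
    rw [testFunOn_eq]
    exact isLinearSpace_testFunComp _
  refine ⟨hbar, hdom, hform.isSmallestClosedExtension (hbc.isClosedForm_scaleForm e) hsub hlin hdom,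
    ⟨hbc.isRegularDirichletForm_scaleForm e, hsc.isRegularDirichletForm_scaleForm e, hsub⟩,
    fun h => ?_, fun h => ?_⟩
  · refine hsc.isACOn_of_mem (m := m) (e := e) hbc fun f hf => ?_
    obtain ⟨w, hw, hwf⟩ := hsc.mem_scaleForm (m := m) e hf
    rw [← h.dense_domain, ← hdom] at hw
    exact ⟨w, hw.1, hwf⟩
  · have heq := hs.acPart_eq hI h hbc
    rw [heq] at hdom
    rw [testFunOn_eq] at hdom hC ⊢
    exact isSpecialStandardCore_testFunComp hval hC hdom.symm
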